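/- Monoids are considered as algebras of type $(2,0)$. A variety of monoids is the class of all monoids satisfying some set of identities, and $\operatorname{var}\Sigma$ denotes the variety given by the identity system $\Sigma$. A variety is a group variety if all its members are groups, a chain variety if its subvarieties form a chain under inclusion, finitely generated if it is generated by a single finite monoid, and locally finite if all its finitely generated members are finite. Every monoid variety that is a chain variety and is not a group variety is contained in some finitely generated variety of monoids; in particular, it is locally finite. Moreover, the variety $$\mathbf D=\operatorname{var}\{x^2\approx x^3,\ x^2y\approx yx^2,\ xyzxty\approx yxzxty,\ xtyzxy\approx xtyzyx,\ y_1y_0x_1y_1x_0x_1\approx y_1y_0y_1x_1x_0x_1\}$$ is contained in the variety generated by the $6$-element Brandt monoid $B_2^1=B_2\cup\{1\}$, where $$B_2=\langle a,b\mid a^2=b^2=0,\ aba=a,\ bab=b\rangle=\{a,b,ab,ba,0\},$$ and the variety $$\mathbf K=\operatorname{var}\{xyx\approx xyx^2,\ x^2y^2\approx y^2x^2,\ x^2y\approx x^2yx\}$$ is contained in the variety generated by the $5$-element monoid $$\langle a,b\mid a^2=ab=a,\ b^2a=b^2\rangle\cup\{1\}=\{a,b,ba,b^2,1\}.$$ 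-/

import Mathlib

/-! # Varieties of monoids -/

universe u

namespace MonoidVar

/-- Possibly empty words over a countably infinite alphabet. -/
abbrev Word := FreeMonoid ℕ

/-- An identity `p.1 ≈ p.2` in the language of monoids (signature `(2,0)`). -/
abbrev Identity := Word × Word

/-- The monoid `M` satisfies the identity `p`: both sides agree under every substitution of
elements of `M` for the letters. -/
def Satisfies (M : Type u) [Monoid M] (p : Identity) : Prop :=
  ∀ φ : Word →* M, φ p.1 = φ p.2

/-- A variety of monoids: a class of monoids that is defined by some set of identities. -/
@[ext]
structure Variety where
  /-- The class of monoids that belong to the variety. -/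
  carrier : Set MonCat.{u}
  /-- The class is equational. -/
  equational : ∃ E : Set Identity, ∀ M : MonCat.{u}, M ∈ carrier ↔ ∀ p ∈ E, Satisfies M p

namespace Variety

/-- Varieties are ordered by inclusion of classes. -/
instance instPartialOrder : PartialOrder Variety.{u} :=
  PartialOrder.lift Variety.carrier (fun _ _ h => Variety.ext h)

/-- The monoid `M` lies in the variety `V`. -/
def Contains (V : Variety.{u}) (M : Type u) [Monoid M] : Prop :=
  MonCat.of M ∈ V.carrier

/-- `var E`: the variety of all monoids that satisfy the identities in `E`. -/
def ofIdentities (E : Set Identity) : Variety.{u} where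
  carrier := {M | ∀ p ∈ E, Satisfies M p}
  equational := ⟨E, fun _ => Iff.rfl⟩

/-- `var M`: the variety generated by the monoid `M`, consisting of all monoids that satisfy every
identity of `M`. It is the least variety that contains `M`, see `isLeast_generatedBy`. -/
def generatedBy (M : Type u) [Monoid M] : Variety.{u} :=
  ofIdentities {p | Satisfies M p}

theorem isLeast_generatedBy (M : Type u) [Monoid M] :
    IsLeast {V : Variety.{u} | V.Contains M} (generatedBy M) := by
  refine ⟨fun p hp => hp, fun V hV N hN => ?_⟩
  obtain ⟨E, hE⟩ := V.equational
  exact (hE N).2 fun p hp => hN p ((hE (MonCat.of M)).1 hV p hp)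

/-- A group variety: all its members are groups. -/
def IsGroupVariety (V : Variety.{u}) : Prop :=
  ∀ (M : Type u) [Monoid M], V.Contains M → ∀ x : M, IsUnit x

/-- A chain variety: its subvarieties form a chain under inclusion. -/
def IsChainVariety (V : Variety.{u}) : Prop :=
  IsChain (· ≤ ·) {X : Variety.{u} | X ≤ V}

/-- A finitely generated variety: it is generated by a finite monoid. -/
def IsFinitelyGenerated (V : Variety.{u}) : Prop :=
  ∃ (M : Type u) (_ : Monoid M), Finite M ∧ V = generatedBy M

/-- A locally finite variety: all its finitely generated members are finite. -/
def IsLocallyFinite (V : Variety.{u}) : Prop :=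
  ∀ (M : Type u) [Monoid M], V.Contains M → Monoid.FG M → Finite M

end Variety

/-- The `i`-th letter, as a word. -/
def letter (i : ℕ) : Word := FreeMonoid.of i

/-- `x ^ 2 ≈ x ^ 3`, `x ^ 2 * y ≈ y * x ^ 2`, `σ₁ : xyzxty ≈ yxzxty`, `σ₂ : xtyzxy ≈ xtyzyx` and
`γ₁ : y₁y₀x₁y₁x₀x₁ ≈ y₁y₀y₁x₁x₀x₁`. -/
def identitiesD : Set Identity :=
  let x := letter 0; let y := letter 1; let z := letter 2; let t := letter 3
  let x₀ := letter 0; let x₁ := letter 1; let y₀ := letter 2; let y₁ := letter 3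
  { (x ^ 2, x ^ 3),
    (x ^ 2 * y, y * x ^ 2),
    (x * y * z * x * t * y, y * x * z * x * t * y),
    (x * t * y * z * x * y, x * t * y * z * y * x),
    (y₁ * y₀ * x₁ * y₁ * x₀ * x₁, y₁ * y₀ * y₁ * x₁ * x₀ * x₁) }

/-- `xyx ≈ xyx²`, `x²y² ≈ y²x²` and `x²y ≈ x²yx`. -/
def identitiesK : Set Identity :=
  let x := letter 0; let y := letter 1
  { (x * y * x, x * y * x ^ 2),
    (x ^ 2 * y ^ 2, y ^ 2 * x ^ 2),
    (x ^ 2 * y, x ^ 2 * y * x) }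

/-- The variety **D**. -/
def varietyD : Variety.{u} := Variety.ofIdentities identitiesD

/-- The variety **K**. -/
def varietyK : Variety.{u} := Variety.ofIdentities identitiesK

/-- The Brandt semigroup `B₂ = ⟨a, b ∣ a² = b² = 0, aba = a, bab = b⟩ = {a, b, ab, ba, 0}`. -/
inductive B2 : Type
  | a | b | ab | ba | zero
  deriving DecidableEq

namespace B2

/-- The multiplication of `B₂`. -/
def mul : B2 → B2 → B2
  | a, b => ab
  | a, ba => a
  | b, a => ba
  | b, ab => b
  | ab, a => a
  | ab, ab => ab
  | ba, b => b
  | ba, ba => ba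
  | _, _ => zero

instance instSemigroup : Semigroup B2 where
  mul := mul
  mul_assoc x y z := by cases x <;> cases y <;> cases z <;> rfl

theorem relations :
    a * b = ab ∧ b * a = ba ∧ a * a = zero ∧ b * b = zero ∧ a * b * a = a ∧ b * a * b = b ∧
      ∀ x : B2, zero * x = zero ∧ x * zero = zero :=
  ⟨rfl, rfl, rfl, rfl, rfl, rfl, fun x => by cases x <;> exact ⟨rfl, rfl⟩⟩

end B2

/-- The Brandt monoid `B₂ ∪ {1}`, which has six elements. -/
abbrev BrandtMonoid : Type := WithOne B2

/-- The semigroup `⟨a, b ∣ a² = ab = a, b²a = b²⟩ = {a, b, ba, b²}`; here `bb` is `b²`. -/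
inductive S4 : Type
  | a | b | ba | bb
  deriving DecidableEq

namespace S4

/-- The multiplication of `S4`. -/
def mul : S4 → S4 → S4
  | a, _ => a
  | b, a => ba
  | b, b => bb
  | b, ba => bb
  | b, bb => bb
  | ba, _ => ba
  | bb, _ => bb

instance instSemigroup : Semigroup S4 where
  mul := mul
  mul_assoc x y z := by cases x <;> cases y <;> cases z <;> rfl

theorem relations :
    b * a = ba ∧ b * b = bb ∧ a * a = a ∧ a * b = a ∧ b * b * a = b * b :=
  ⟨rfl, rfl, rfl, rfl, rfl⟩

end S4

/-- The monoid `⟨a, b ∣ a² = ab = a, b²a = b²⟩ ∪ {1} = {a, b, ba, b², 1}`, which has five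
elements. -/
abbrev FiveMonoid : Type := WithOne S4

end MonoidVar

/-!
A chain variety `V` that is not a group variety contains the two-element semilattice, with which no
nontrivial cyclic group is comparable, so `V` satisfies `xⁿ ≈ xⁿ⁺¹` for some `n`. If in addition a
letter can be deleted from a product as soon as it occurs `n` times further to the left, words may
be truncated, and `V` lies in the variety of a finite monoid that acts on truncated words over two
letters. Such a deletion law holds when `V` is commutative, when, up to duality, `V` consists of
bands or contains the monoid `{1, e, t, 0}` with `e² = e`, `te = t` and `et = t² = 0`, and when `V`
and its dual omit that monoid, so that squares are central, while `xyxzx` forms a nontrivial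
identity of `V`.

If squares are central and `xyxzx` is an isoterm for `V`, then `V ≤ D`: for each of the words
`xyzxty`, `xtyzxy` and `y₁y₀x₁y₁x₀x₁` the monoid of its factors is incomparable with that of
`xyxzx`, so that none of them is an isoterm, and the only identity that it can form is the one
that defines `D`. The identities of the Brandt monoid preserve, for every letter `x`, the
restriction of a word to `x` and the letters that occur once in it, unless `xx` is a factor of
this restriction; in that case, the laws of `D` move all the occurrences of `x` to the front.
-/

namespace MonoidVar

section Words

variable {α M N : Type*} [Monoid M] [Monoid N]

theorem prod_map_filter (f : α → M) (p : α → Prop) [DecidablePred p] (l : List α) :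
    ((l.filter p).map f).prod = (l.map fun a => if p a then f a else 1).prod := by
  induction l with
  | nil => rfl
  | cons a l ih => by_cases hp : p a <;> simp [hp, ih]

theorem unop_prod_map (f : α → Mᵐᵒᵖ) (l : List α) :
    (l.map f).prod.unop = (l.reverse.map fun a => (f a).unop).prod := by
  rw [MulOpposite.unop_list_prod, List.map_map, List.map_reverse, Function.comp_def]

/-- The identity `u ≈ v` between words, given as lists of letters, holds in `M`. -/
def Holds (M : Type*) [Monoid M] (u v : List ℕ) : Prop :=
  ∀ f : ℕ → M, (u.map f).prod = (v.map f).prod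

variable {u v : List ℕ}

theorem satisfies_iff_holds {p : Identity} :
    Satisfies M p ↔ Holds M p.1.toList p.2.toList := by
  refine ⟨fun h f => by simpa only [FreeMonoid.lift_apply] using h (FreeMonoid.lift f),
    fun h φ => ?_⟩
  simpa only [← FreeMonoid.lift_apply, FreeMonoid.lift_restrict] using h (φ ∘ FreeMonoid.of)

theorem Holds.symm (h : Holds M u v) : Holds M v u :=
  fun f => (h f).symm

theorem Holds.of_injective (φ : M →* N) (hφ : Function.Injective φ) (h : Holds N u v) :
    Holds M u v := fun f => hφ <| by
  simpa only [map_list_prod, List.map_map] using h (φ ∘ f)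

theorem holds_ulift : Holds (ULift.{u} M) u v ↔ Holds M u v :=
  ⟨.of_injective MulEquiv.ulift.symm.toMonoidHom (MulEquiv.injective _),
    .of_injective MulEquiv.ulift.toMonoidHom (MulEquiv.injective _)⟩

theorem holds_mulOpposite : Holds Mᵐᵒᵖ u v ↔ Holds M u.reverse v.reverse := by
  refine ⟨fun h f => ?_, fun h f => MulOpposite.unop_injective ?_⟩
  · simpa only [unop_prod_map, MulOpposite.unop_op] using
      congrArg MulOpposite.unop (h fun i => MulOpposite.op (f i))
  · simpa only [unop_prod_map] using h fun i => (f i).unop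

theorem Holds.filter (h : Holds M u v) (p : ℕ → Prop) [DecidablePred p] :
    Holds M (u.filter p) (v.filter p) := fun f => by
  rw [prod_map_filter, prod_map_filter, h]

theorem prod_map_eq_of_forall_holds {ι : Type*} [Countable ι] {w w' : List ι}
    (hMN : ∀ u v, Holds N u v → Holds M u v)
    (h : ∀ f : ι → N, (w.map f).prod = (w'.map f).prod) (g : ι → M) :
    (w.map g).prod = (w'.map g).prod := by
  obtain ⟨e, he⟩ := exists_injective_nat ι
  have hN : Holds N (w.map e) (w'.map e) := fun f => by
    simpa only [List.map_map] using h (f ∘ e)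
  simpa only [List.map_map, Function.extend_comp he] using hMN _ _ hN (Function.extend e g 1)

end Words

namespace Variety

variable {V W : Variety.{u}} {u v : List ℕ}

/-- The identity `u ≈ v` holds in every member of the variety `V`. -/
def Entails (V : Variety.{u}) (u v : List ℕ) : Prop :=
  ∀ (M : Type u) [Monoid M], V.Contains M → Holds M u v

/-- The small monoid `M` lies, up to a universe lift, in the variety `V`. -/
def ContainsLift (V : Variety.{u}) (M : Type) [Monoid M] : Prop := V.Contains (ULift.{u} M)

theorem contains_iff {M : Type u} [Monoid M] :
    V.Contains M ↔ ∀ u v, V.Entails u v → Holds M u v := by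
  refine ⟨fun h u v huv => huv M h, fun h => ?_⟩
  obtain ⟨E, hE⟩ := V.equational
  exact (hE _).2 fun p hp => satisfies_iff_holds.2 <| h _ _ fun N _ hN =>
    satisfies_iff_holds.1 ((hE (MonCat.of N)).1 hN p hp)

theorem containsLift_iff {M : Type} [Monoid M] :
    V.ContainsLift M ↔ ∀ u v, V.Entails u v → Holds M u v := by
  simp only [ContainsLift, contains_iff, holds_ulift]

theorem Entails.symm (h : V.Entails u v) : V.Entails v u :=
  fun M _ hM => (h M hM).symm

theorem contains_generatedBy_iff {M N : Type u} [Monoid M] [Monoid N] :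
    (generatedBy M).Contains N ↔ ∀ u v, Holds M u v → Holds N u v := by
  refine ⟨fun h u v huv => ?_, fun h p hp => ?_⟩
  · exact satisfies_iff_holds.1 (h (FreeMonoid.ofList u, FreeMonoid.ofList v)
      (satisfies_iff_holds.2 huv))
  · exact satisfies_iff_holds.2 (h _ _ (satisfies_iff_holds.1 hp))

theorem le_generatedBy_ulift_iff {M : Type} [Monoid M] :
    V ≤ generatedBy (ULift.{u} M) ↔
      ∀ (N : Type u) [Monoid N], V.Contains N → ∀ u v, Holds M u v → Holds N u v := by
  refine ⟨fun h N _ hN u v huv => ?_, fun h N hN => ?_⟩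
  · exact contains_generatedBy_iff.1 (h hN) u v (holds_ulift.2 huv)
  · exact contains_generatedBy_iff (N := N).2 fun u v huv => h N hN u v (holds_ulift.1 huv)

theorem IsChainVariety.comparable (hV : V.IsChainVariety) {M N : Type} [Monoid M] [Monoid N]
    (hM : V.ContainsLift M) (hN : V.ContainsLift N) :
    (∀ u v, Holds M u v → Holds N u v) ∨ ∀ u v, Holds N u v → Holds M u v := by
  have holds_of_le {P Q : Type} [Monoid P] [Monoid Q]
      (h : generatedBy (ULift.{u} P) ≤ generatedBy (ULift.{u} Q)) (u v) (huv : Holds Q u v) :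
      Holds P u v :=
    holds_ulift.1 (le_generatedBy_ulift_iff.1 h _ (isLeast_generatedBy _).1 u v huv)
  exact (hV.total ((isLeast_generatedBy _).2 hM) ((isLeast_generatedBy _).2 hN)).symm.imp
    holds_of_le holds_of_le

theorem IsChainVariety.not_separated (hV : V.IsChainVariety) {M N : Type} [Monoid M] [Monoid N]
    (hM : V.ContainsLift M) (hN : V.ContainsLift N) {u v u' v' : List ℕ}
    (hMuv : Holds M u v) (hNuv : ¬ Holds N u v) (hNuv' : Holds N u' v') (hMuv' : ¬ Holds M u' v') :
    False :=
  (hV.comparable hM hN).elim (fun h => hNuv (h _ _ hMuv)) fun h => hMuv' (h _ _ hNuv')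

/-- The dual variety: the opposites of the members of `V`. -/
def op (V : Variety.{u}) : Variety.{u} where
  carrier := {M | V.Contains Mᵐᵒᵖ}
  equational := by
    refine ⟨{p | V.Entails p.1.toList.reverse p.2.toList.reverse}, fun M => ?_⟩
    simp only [Set.mem_ofPred_eq, contains_iff, holds_mulOpposite, satisfies_iff_holds]
    refine ⟨fun h p hp => by simpa using h _ _ hp, fun h u v huv => ?_⟩
    simpa [huv] using h (FreeMonoid.ofList u.reverse, FreeMonoid.ofList v.reverse)

theorem op_contains {M : Type u} [Monoid M] : V.op.Contains M ↔ V.Contains Mᵐᵒᵖ := Iff.rfl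

theorem op_contains_mulOpposite {M : Type u} [Monoid M] : V.op.Contains Mᵐᵒᵖ ↔ V.Contains M := by
  rw [op_contains, contains_iff, contains_iff]
  simp [holds_mulOpposite]

theorem op_entails : V.op.Entails u v ↔ V.Entails u.reverse v.reverse := by
  refine ⟨fun h M _ hM => ?_, fun h M _ hM => ?_⟩
  · exact holds_mulOpposite.1 (h Mᵐᵒᵖ (op_contains_mulOpposite.2 hM))
  · simpa [holds_mulOpposite] using h Mᵐᵒᵖ hM

theorem op_containsLift {M : Type} [Monoid M] : V.op.ContainsLift M ↔ V.ContainsLift Mᵐᵒᵖ := by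
  simp only [containsLift_iff, op_entails, holds_mulOpposite]
  exact ⟨fun h u v huv => h _ _ (by simpa using huv), fun h u v huv => by simpa using h _ _ huv⟩

theorem op_op (V : Variety.{u}) : V.op.op = V := by
  ext M
  exact op_contains_mulOpposite (M := M)

theorem op_mono (h : V ≤ W) : V.op ≤ W.op := fun M hM =>
  h (show MonCat.of (M : Type u)ᵐᵒᵖ ∈ V.carrier from hM)

theorem op_le_op : V.op ≤ W.op ↔ V ≤ W :=
  ⟨fun h => by simpa only [op_op] using op_mono h, op_mono⟩

theorem IsChainVariety.op (hV : V.IsChainVariety) : V.op.IsChainVariety := by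
  intro X hX Y hY _
  have op_le {Z : Variety.{u}} (hZ : Z ≤ V.op) : Z.op ≤ V := by simpa [op_op] using op_mono hZ
  simpa only [op_le_op] using hV.total (op_le hX) (op_le hY)

theorem IsGroupVariety.of_op (hV : V.op.IsGroupVariety) : V.IsGroupVariety := fun _ _ hM x =>
  isUnit_op.1 (hV _ (op_contains_mulOpposite.2 hM) (MulOpposite.op x))

end Variety

section Truncation

variable {α : Type*} [DecidableEq α] {n : ℕ}

/-- Appends a letter to a word, unless it already occurs there `n` times. -/
def truncAppend (n : ℕ) (l : List α) (a : α) : List α :=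
  if l.count a < n then l ++ [a] else l

/-- `truncate n l` keeps the first `n` occurrences of every letter of `l`. -/
def truncate (n : ℕ) (l : List α) : List α :=
  l.foldl (truncAppend n) []

theorem truncate_concat (l : List α) (a : α) :
    truncate n (l ++ [a]) = truncAppend n (truncate n l) a := by
  rw [truncate, List.foldl_concat, truncate]

theorem count_truncAppend_le {l : List α} (hl : ∀ b, l.count b ≤ n) (a b : α) :
    (truncAppend n l a).count b ≤ n := by
  have := hl b
  rw [truncAppend]
  split_ifs with ha
  · rcases eq_or_ne a b with rfl | hab
    · rwa [List.count_append, List.count_singleton_self]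
    · rwa [List.count_append, List.count_singleton, beq_false_of_ne hab]
  · exact this

/-- The condition on `M` that a letter can be deleted from a product if it occurs at least `n`
times further to the left. -/
def RightAbsorbs (n : ℕ) (M : Type*) [Monoid M] : Prop :=
  ∀ (f : ℕ → M) (w : List ℕ) (x : ℕ), n ≤ w.count x → (w.map f).prod * f x = (w.map f).prod

theorem RightAbsorbs.prod_truncate {M : Type*} [Monoid M] (h : RightAbsorbs n M) (f : ℕ → M)
    (w : List ℕ) : ((truncate n w).map f).prod = (w.map f).prod := by
  induction w using List.reverseRecOn with
  | nil => rfl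
  | append_singleton w a ih =>
    rw [truncate_concat, truncAppend, List.map_append, List.prod_append, ← ih]
    split_ifs with ha
    · rw [List.map_append, List.prod_append]
    · rw [List.map_singleton, List.prod_singleton, h f _ a (not_lt.1 ha)]

end Truncation

section TruncMonoid

variable {n : ℕ}

/-- The truncated words over a two-letter alphabet, as the states of a finite automaton. -/
def TruncState (n : ℕ) : Type := {l : List Bool // ∀ b, l.count b ≤ n}

instance finite_truncState (n : ℕ) : Finite (TruncState n) := by
  have length_le : {l : List Bool | ∀ b, l.count b ≤ n} ⊆ {l | l.length ≤ 2 * n} := by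
    intro l hl
    have := l.count_true_add_count_false
    have := hl true
    have := hl false
    simp only [Set.mem_ofPred_eq]
    omega
  exact ((List.finite_length_le Bool (2 * n)).subset length_le).to_subtype

/-- The finite monoid of transformations of truncated words, acting on the right. Its identities
are the pairs of words all of whose restrictions to two letters have equal truncations. -/
abbrev TruncMonoid (n : ℕ) : Type := (Function.End (TruncState n))ᵐᵒᵖ

instance finite_truncMonoid (n : ℕ) : Finite (TruncMonoid n) :=
  Finite.of_equiv (TruncState n → TruncState n) MulOpposite.opEquiv

/-- The action on truncated words of a letter of the two-letter alphabet, or of no letter. -/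
def truncStep (n : ℕ) : Option Bool → TruncMonoid n
  | none => 1
  | some b => MulOpposite.op fun s => ⟨truncAppend n s.1 b, count_truncAppend_le s.2 b⟩

/-- The letters `x` and `y` of a two-letter alphabet; the other letters are forgotten. -/
def pairLetter (x y z : ℕ) : Option Bool :=
  if z = x then some true else if z = y then some false else none

theorem eq_of_filterMap_pairLetter {l m : List ℕ}
    (h : ∀ x y, l.filterMap (pairLetter x y) = m.filterMap (pairLetter x y)) : l = m := by
  induction l generalizing m with
  | nil =>
    cases m with
    | nil => rfl
    | cons b m => simpa [pairLetter] using h b b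
  | cons a l ih =>
    cases m with
    | nil => simpa [pairLetter] using h a a
    | cons b m =>
      obtain rfl : a = b := by
        by_contra hab
        simpa [pairLetter, Ne.symm hab] using h a b
      refine congrArg (a :: ·) (ih fun x y => ?_)
      have hxy := h x y
      rw [List.filterMap_cons, List.filterMap_cons] at hxy
      cases hp : pairLetter x y a <;> simpa [hp] using hxy

theorem count_filterMap_pairLetter {x y z : ℕ} {b : Bool} (h : pairLetter x y z = some b)
    (l : List ℕ) : (l.filterMap (pairLetter x y)).count b = l.count z := by
  rw [List.count_filterMap, List.count_eq_countP]
  refine List.countP_congr fun a _ => ?_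
  simp only [pairLetter] at h ⊢
  grind

theorem prod_truncStep_apply (x y : ℕ) (w : List ℕ) {s : TruncState n} (hs : s.1 = []) :
    ((w.map fun z => truncStep n (pairLetter x y z)).prod.unop s).1 =
      (truncate n w).filterMap (pairLetter x y) := by
  induction w using List.reverseRecOn with
  | nil => exact hs
  | append_singleton w a ih =>
    rw [List.map_append, List.prod_append, truncate_concat, truncAppend]
    cases hp : pairLetter x y a with
    | none => split_ifs <;> simpa [truncStep, hp] using ih
    | some b =>
      have step (g : TruncMonoid n) : ((g * truncStep n (some b)).unop s).1 =
          truncAppend n (g.unop s).1 b := rfl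
      rw [List.map_singleton, List.prod_singleton, hp, step, truncAppend, ih,
        count_filterMap_pairLetter hp]
      split_ifs <;> simp [hp]

theorem truncate_eq_of_holds {u v : List ℕ} (h : Holds (TruncMonoid n) u v) :
    truncate n u = truncate n v := by
  refine eq_of_filterMap_pairLetter fun x y => ?_
  let s : TruncState n := ⟨[], fun _ => Nat.zero_le n⟩
  rw [← prod_truncStep_apply x y u (s := s) rfl, h, prod_truncStep_apply x y v rfl]

theorem RightAbsorbs.holds {M : Type*} [Monoid M] {u v : List ℕ} (h : RightAbsorbs n M)
    (huv : Holds (TruncMonoid n) u v) : Holds M u v := fun f => by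
  rw [← h.prod_truncate f u, ← h.prod_truncate f v, truncate_eq_of_holds huv]

end TruncMonoid

namespace Variety

variable {V W : Variety.{u}}

/-- Every member of `V` satisfies `RightAbsorbs n`. -/
def IsRightAbsorbing (V : Variety.{u}) (n : ℕ) : Prop :=
  ∀ (M : Type u) [Monoid M], V.Contains M → RightAbsorbs n M

theorem isFinitelyGenerated_generatedBy_ulift {M : Type} [Monoid M] [Finite M] :
    (generatedBy (ULift.{u} M)).IsFinitelyGenerated :=
  ⟨ULift.{u} M, inferInstance, inferInstance, rfl⟩

theorem IsRightAbsorbing.exists_isFinitelyGenerated {n : ℕ} (h : V.IsRightAbsorbing n) :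
    ∃ W : Variety.{u}, W.IsFinitelyGenerated ∧ V ≤ W :=
  ⟨_, isFinitelyGenerated_generatedBy_ulift (M := TruncMonoid n),
    le_generatedBy_ulift_iff.2 fun N _ hN _ _ => (h N hN).holds⟩

theorem op_generatedBy (M : Type u) [Monoid M] : (generatedBy M).op = generatedBy Mᵐᵒᵖ := by
  ext N
  change (generatedBy M).Contains Nᵐᵒᵖ ↔ (generatedBy Mᵐᵒᵖ).Contains N
  simp only [contains_generatedBy_iff, holds_mulOpposite]
  exact ⟨fun h u v huv => by simpa using h _ _ huv, fun h u v huv => h _ _ (by simpa using huv)⟩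

theorem IsFinitelyGenerated.op (hW : W.IsFinitelyGenerated) : W.op.IsFinitelyGenerated := by
  obtain ⟨M, _, _, rfl⟩ := hW
  exact ⟨Mᵐᵒᵖ, inferInstance, Finite.of_equiv M MulOpposite.opEquiv, op_generatedBy M⟩

theorem exists_isFinitelyGenerated_of_op
    (h : ∃ W : Variety.{u}, W.IsFinitelyGenerated ∧ V.op ≤ W) :
    ∃ W : Variety.{u}, W.IsFinitelyGenerated ∧ V ≤ W :=
  let ⟨W, hW, hVW⟩ := h
  ⟨W.op, hW.op, op_le_op.1 (by rwa [op_op])⟩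

theorem IsFinitelyGenerated.isLocallyFinite_of_le (hW : W.IsFinitelyGenerated) (hVW : V ≤ W) :
    V.IsLocallyFinite := by
  obtain ⟨P, _, _, rfl⟩ := hW
  intro M _ hM hfg
  obtain ⟨S, hS, φ, hφ⟩ := Monoid.fg_iff_exists_freeMonoid_hom_surjective.1 hfg
  have : Finite S := hS
  have hPM : ∀ u v, Holds P u v → Holds M u v := contains_generatedBy_iff.1 (hVW hM)
  choose w hw using hφ
  refine Finite.of_injective (fun m (f : S → P) => FreeMonoid.lift f (w m)) fun a b hab => ?_
  rw [← hw a, ← hw b, ← FreeMonoid.lift_restrict φ]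
  simp only [FreeMonoid.lift_apply] at hab ⊢
  exact prod_map_eq_of_forall_holds hPM (congrFun hab) _

end Variety

section Products

variable {α : Type*} {x : α} {w : List α}

theorem exists_last_new_letter (hw : w ≠ []) :
    ∃ p x s, w = p ++ x :: s ∧ x ∉ p ∧ s ⊆ p ++ [x] := by
  classical
  induction w using List.reverseRecOn with
  | nil => exact absurd rfl hw
  | append_singleton w c ih =>
    by_cases hc : c ∈ w
    · obtain ⟨p, x, s, rfl, hx, hs⟩ := ih (List.ne_nil_of_mem hc)
      refine ⟨p, x, s ++ [c], by simp, hx, List.append_subset.2 ⟨hs, ?_⟩⟩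
      rw [← List.singleton_append, ← List.append_assoc, List.mem_append] at hc
      simpa using hc.elim id fun hc => hs hc
    · exact ⟨w, c, [], rfl, hc, List.nil_subset _⟩

variable [DecidableEq α]

theorem exists_eq_append_cons_append_cons (h : 2 ≤ w.count x) :
    ∃ p q r, w = p ++ x :: (q ++ x :: r) := by
  obtain ⟨p, s, rfl, hp⟩ :=
    List.eq_append_cons_of_mem (List.count_pos_iff.1 (zero_lt_two.trans_le h))
  rw [List.count_append, List.count_cons_self, List.count_eq_zero.2 hp] at h
  obtain ⟨q, r, rfl⟩ := List.append_of_mem (List.count_pos_iff.1 (by omega : 0 < s.count x))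
  exact ⟨p, q, r, rfl⟩

theorem prod_map_update_one {M : Type*} [Monoid M] (m : M) (x : α) (w : List α) :
    (w.map (Function.update 1 x m)).prod = m ^ w.count x := by
  rw [List.prod_map_eq_pow_single x, Function.update_self]
  exact fun y hy _ => Function.update_of_ne hy _ _

theorem map_update_of_notMem {M : Type*} (f : α → M) (m : M) (hx : x ∉ w) :
    w.map (Function.update f x m) = w.map f :=
  List.map_congr_left fun _ hz => Function.update_of_ne (ne_of_mem_of_not_mem hz hx) _ _

end Products

/-! ### The variety `K` -/

section VarietyK

variable {M : Type*} [Monoid M]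

theorem rightAbsorbs_two (h₁ : ∀ x y : M, x * y * x = x * y * x ^ 2)
    (h₂ : ∀ x y : M, x ^ 2 * y = x ^ 2 * y * x) : RightAbsorbs 2 M := by
  intro f w x hx
  obtain ⟨p, q, r, rfl⟩ := exists_eq_append_cons_append_cons hx
  have absorb (a b c : M) : a * b * a * c * a = a * b * a * c := by
    rw [h₁, mul_assoc _ _ c, mul_assoc _ _ a, ← h₂]
  simpa [mul_assoc] using congrArg ((p.map f).prod * ·) (absorb (f x) (q.map f).prod (r.map f).prod)

theorem RightAbsorbs.prod_append {n : ℕ} (h : RightAbsorbs n M) (f : ℕ → M) {p w : List ℕ}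
    (hw : ∀ x ∈ w, n ≤ p.count x) : ((p ++ w).map f).prod = (p.map f).prod := by
  induction w using List.reverseRecOn with
  | nil => rw [List.append_nil]
  | append_singleton w a ih =>
    have ha : n ≤ (p ++ w).count a := (hw a (by simp)).trans (by simp)
    rw [← List.append_assoc, List.map_append, List.prod_append, List.map_singleton,
      List.prod_singleton, h f _ a ha, ih fun x hx => hw x (by simp [hx])]

/-- The laws that define the variety **K**. -/
structure LawsK (M : Type*) [Monoid M] : Prop where
  mul_mul_self : ∀ x y : M, x * y * x = x * y * x ^ 2
  sq_mul_sq : ∀ x y : M, x ^ 2 * y ^ 2 = y ^ 2 * x ^ 2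
  sq_mul : ∀ x y : M, x ^ 2 * y = x ^ 2 * y * x

namespace LawsK

theorem rightAbsorbs (h : LawsK M) : RightAbsorbs 2 M :=
  rightAbsorbs_two h.mul_mul_self h.sq_mul

variable {α : Type*} {p w w' : List α} {x y : α}

theorem prod_mul_eq_prod_mul_sq (h : LawsK M) (f : α → M) (hx : x ∈ p) :
    (p.map f).prod * f x = (p.map f).prod * f x ^ 2 := by
  obtain ⟨q, r, rfl⟩ := List.append_of_mem hx
  simpa [mul_assoc] using congrArg ((q.map f).prod * ·) (h.mul_mul_self (f x) (r.map f).prod)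

theorem prod_mul_mul_comm (h : LawsK M) (f : α → M) (hx : x ∈ p) (hy : y ∈ p) :
    (p.map f).prod * f x * f y = (p.map f).prod * f y * f x := by
  have eq_sq_mul_sq {x y : α} (hx : x ∈ p) (hy : y ∈ p) :
      (p.map f).prod * f x * f y = (p.map f).prod * (f x ^ 2 * f y ^ 2) := by
    have := h.prod_mul_eq_prod_mul_sq f (List.mem_append_left [x] hy)
    rwa [List.map_append, List.prod_append, List.map_singleton, List.prod_singleton,
      h.prod_mul_eq_prod_mul_sq f hx, mul_assoc _ _ (f y ^ 2),
      ← h.prod_mul_eq_prod_mul_sq f hx] at this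
  rw [eq_sq_mul_sq hx hy, h.sq_mul_sq, eq_sq_mul_sq hy hx]

theorem prod_append_perm (h : LawsK M) (f : α → M) (hww' : w.Perm w') (hw : w ⊆ p) :
    ((p ++ w).map f).prod = ((p ++ w').map f).prod := by
  induction hww' generalizing p with
  | nil => rfl
  | cons x _ ih =>
    have := @ih (p ++ [x]) fun z hz => List.mem_append_left _ (hw (List.mem_cons_of_mem x hz))
    rwa [List.append_assoc, List.append_assoc] at this
  | swap x y w =>
    have := h.prod_mul_mul_comm f (hw List.mem_cons_self)
      (hw (List.mem_cons_of_mem y List.mem_cons_self))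
    simp only [List.map_append, List.map_cons, List.prod_append, List.prod_cons, ← mul_assoc, this]
  | trans hww' _ ih₁ ih₂ => rw [ih₁ hw, ih₂ fun z hz => hw (hww'.mem_iff.2 hz)]

end LawsK

theorem lawsK_of_contains {M : Type u} [Monoid M] (hM : varietyK.Contains M) : LawsK M := by
  have law (p) (hp : p ∈ identitiesK) (x y : M) :=
    hM p hp (FreeMonoid.lift fun i => if i = 0 then x else y)
  exact ⟨fun x y => by simpa [letter] using law _ (Or.inl rfl) x y,
    fun x y => by simpa [letter] using law _ (Or.inr (Or.inl rfl)) x y,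
    fun x y => by simpa [letter] using law _ (Or.inr (Or.inr rfl)) x y⟩

end VarietyK

section FiveMonoid

theorem five_mul_a_mul (m n : FiveMonoid) : m * (S4.a : FiveMonoid) * n = m * S4.a := by
  rcases m with _ | (_ | _ | _ | _) <;> rcases n with _ | (_ | _ | _ | _) <;> rfl

theorem five_mul_ba_mul (m n : FiveMonoid) : m * (S4.ba : FiveMonoid) * n = m * S4.ba := by
  rcases m with _ | (_ | _ | _ | _) <;> rcases n with _ | (_ | _ | _ | _) <;> rfl

theorem five_ext {m n : FiveMonoid} (ha : m * (S4.a : FiveMonoid) = n * S4.a)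
    (hba : m * (S4.ba : FiveMonoid) = n * S4.ba) : m = n := by
  rcases m with _ | (_ | _ | _ | _) <;> rcases n with _ | (_ | _ | _ | _) <;>
    solve | rfl | cases ha | cases hba

theorem five_b_pow (n : ℕ) : (S4.b : FiveMonoid) ^ (n + 2) = S4.bb := by
  induction n with
  | zero => rfl
  | succ n ih => rw [pow_succ, ih]; rfl

theorem min_two_eq_of_five_b_pow_eq :
    ∀ {m n : ℕ}, (S4.b : FiveMonoid) ^ m = S4.b ^ n → min m 2 = min n 2
  | 0, 0, _ | 1, 1, _ => rfl
  | 0, 1, h | 1, 0, h => nomatch h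
  | 0, n + 2, h | 1, n + 2, h => by rw [five_b_pow] at h; cases h
  | m + 2, 0, h | m + 2, 1, h => by rw [five_b_pow] at h; cases h
  | m + 2, n + 2, _ => by simp

variable {u v p p' w w' : List ℕ}

theorem min_count_two_eq_of_holds_five (h : Holds FiveMonoid u v) (x : ℕ) :
    min (u.count x) 2 = min (v.count x) 2 :=
  min_two_eq_of_five_b_pow_eq <| by
    simpa only [prod_map_update_one] using h (Function.update 1 x (S4.b : FiveMonoid))

theorem mem_iff_of_holds_five (h : Holds FiveMonoid u v) {x : ℕ} : x ∈ u ↔ x ∈ v := by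
  have := min_count_two_eq_of_holds_five h x
  rw [← List.count_pos_iff, ← List.count_pos_iff]
  omega

theorem holds_five_prefix {y : ℕ} (h : Holds FiveMonoid (p ++ y :: w) (p' ++ y :: w'))
    (hp : y ∉ p) (hp' : y ∉ p') : Holds FiveMonoid p p' := by
  intro f
  have prod_mul (m : FiveMonoid) := h (Function.update f y m)
  simp only [List.map_append, List.map_cons, List.prod_append, List.prod_cons, ← mul_assoc,
    map_update_of_notMem f _ hp, map_update_of_notMem f _ hp', Function.update_self] at prod_mul
  exact five_ext (by simpa only [five_mul_a_mul] using prod_mul S4.a)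
    (by simpa only [five_mul_ba_mul] using prod_mul S4.ba)

theorem LawsK.holds_append {M : Type*} [Monoid M] (hM : LawsK M) (hw : w ⊆ p) (hw' : w' ⊆ p)
    (h : Holds FiveMonoid (p ++ w) (p ++ w')) : Holds M (p ++ w) (p ++ w') := by
  intro f
  have two_le_count {w w' : List ℕ} (h : Holds FiveMonoid (p ++ w) (p ++ w')) (hw : w' ⊆ p) :
      ∀ x ∈ w', 2 ≤ (p ++ w).count x := by
    intro x hx
    have := min_count_two_eq_of_holds_five h x
    have := List.count_pos_iff.2 hx
    have := List.count_pos_iff.2 (hw hx)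
    simp only [List.count_append] at *
    omega
  calc ((p ++ w).map f).prod
      = ((p ++ w ++ w').map f).prod := (hM.rightAbsorbs.prod_append f (two_le_count h hw')).symm
    _ = ((p ++ w' ++ w).map f).prod := by
        simpa only [List.append_assoc] using
          hM.prod_append_perm f List.perm_append_comm (List.append_subset.2 ⟨hw, hw'⟩)
    _ = ((p ++ w').map f).prod := hM.rightAbsorbs.prod_append f (two_le_count h.symm hw)

theorem LawsK.holds_of_holds_five {M : Type*} [Monoid M] (hM : LawsK M)
    (h : Holds FiveMonoid u v) : Holds M u v := by
  induction hn : u.length using Nat.strong_induction_on generalizing u v with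
  | _ n ih =>
  rcases eq_or_ne u [] with rfl | hu
  · obtain rfl : v = [] := List.eq_nil_iff_forall_not_mem.2 fun x hx => by
      simpa using (mem_iff_of_holds_five h).2 hx
    exact fun _ => rfl
  obtain ⟨p, y, w, rfl, hy, hw⟩ := exists_last_new_letter hu
  obtain ⟨p', w', rfl, hy'⟩ :=
    List.eq_append_cons_of_mem ((mem_iff_of_holds_five h (x := y)).1 (by simp))
  have hpp' : Holds FiveMonoid p p' := holds_five_prefix h hy hy'
  have hpM : Holds M p p' := ih p.length (by simp [← hn]) hpp' rfl
  have letters {z : ℕ} : z ∈ p' ++ [y] ↔ z ∈ p ++ [y] := by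
    simp only [List.mem_append, mem_iff_of_holds_five hpp']
  have hw' : w' ⊆ p ++ [y] := fun z hz => by
    have hzu : z ∈ (p ++ [y]) ++ w := by
      simpa using (mem_iff_of_holds_five h).2 (by simp [hz] : z ∈ p' ++ y :: w')
    exact (List.mem_append.1 hzu).elim id fun hz => hw hz
  have tail : Holds M (p' ++ [y] ++ w) (p' ++ [y] ++ w') :=
    hM.holds_append (fun z hz => letters.2 (hw hz)) (fun z hz => letters.2 (hw' hz)) fun f => by
      simpa [hpp' f, mul_assoc] using h f
  intro f
  simpa [hpM f, mul_assoc] using tail f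

end FiveMonoid

theorem varietyK_le : varietyK.{u} ≤ Variety.generatedBy (ULift.{u} FiveMonoid) :=
  Variety.le_generatedBy_ulift_iff.2 fun _ _ hN _ _ => (lawsK_of_contains hN).holds_of_holds_five

/-! ### The variety `D` -/

section VarietyD

/-- The laws that define the variety **D**. -/
structure LawsD (M : Type*) [Monoid M] : Prop where
  sq : ∀ x : M, x ^ 2 = x ^ 3
  sq_mul_comm : ∀ x y : M, x ^ 2 * y = y * x ^ 2
  sigma₁ : ∀ x y z t : M, x * y * z * x * t * y = y * x * z * x * t * y
  sigma₂ : ∀ x y z t : M, x * t * y * z * x * y = x * t * y * z * y * x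
  gamma₁ : ∀ x₀ x₁ y₀ y₁ : M, y₁ * y₀ * x₁ * y₁ * x₀ * x₁ = y₁ * y₀ * y₁ * x₁ * x₀ * x₁

theorem varietyD_contains_iff {M : Type u} [Monoid M] : varietyD.Contains M ↔ LawsD M := by
  constructor
  · intro hM
    have law (p) (hp : p ∈ identitiesD) (x y z t : M) := hM p hp
      (FreeMonoid.lift fun i => if i = 0 then x else if i = 1 then y else if i = 2 then z else t)
    refine ⟨fun x => ?_, fun x y => ?_, fun x y z t => ?_, fun x y z t => ?_, fun x y z t => ?_⟩
    · simpa [letter] using law _ (Or.inl rfl) x x x x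
    · simpa [letter] using law _ (Or.inr (Or.inl rfl)) x y y y
    · simpa [letter] using law _ (Or.inr (Or.inr (Or.inl rfl))) x y z t
    · simpa [letter] using law _ (Or.inr (Or.inr (Or.inr (Or.inl rfl)))) x y z t
    · simpa [letter] using law _ (Or.inr (Or.inr (Or.inr (Or.inr rfl)))) x y z t
  · intro h p hp φ
    rcases hp with rfl | rfl | rfl | rfl | rfl <;> simp only [map_mul, map_pow]
    exacts [h.sq _, h.sq_mul_comm _ _, h.sigma₁ _ _ _ _, h.sigma₂ _ _ _ _, h.gamma₁ _ _ _ _]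

variable {α : Type*} {l p q r r' s : List α} {x y : α}

theorem exists_eq_append_cons_append_cons_of_ne (hx : x ∈ l) (hy : y ∈ l) (hxy : x ≠ y) :
    ∃ a b c, l = a ++ x :: (b ++ y :: c) ∨ l = a ++ y :: (b ++ x :: c) := by
  obtain ⟨a, s, rfl⟩ := List.append_of_mem hx
  rw [List.mem_append, List.mem_cons, or_iff_right hxy.symm] at hy
  rcases hy with hy | hy <;> obtain ⟨b, c, rfl⟩ := List.append_of_mem hy
  · exact ⟨b, c, s, Or.inr (by simp)⟩
  · exact ⟨a, b, c, Or.inl rfl⟩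

theorem append_cons_inj_of_notMem_of_notMem (hp : x ∉ p) (hq : x ∉ q) :
    p ++ x :: r = q ++ x :: s ↔ p = q ∧ r = s := by
  refine ⟨fun h => ?_, fun ⟨hpq, hrs⟩ => hpq ▸ hrs ▸ rfl⟩
  rcases List.append_eq_append_iff.1 h with ⟨c, rfl, hc⟩ | ⟨c, rfl, hc⟩ <;> cases c <;> simp_all

section Filter

variable [DecidableEq α] {L : α → Prop} [DecidablePred L] {u v u₀ v₀ u₁ v₁ : List α} {t : α}

theorem perm_of_filter_eq
    (h : ∀ x, u.filter (fun z => z = x ∨ L z) = v.filter (fun z => z = x ∨ L z)) : u.Perm v :=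
  List.perm_iff_count.2 fun x => by
    simpa [List.count_filter] using congrArg (List.count x) (h x)

theorem filter_split (hu₀ : ∀ y ∈ u₀, ¬ L y) (hv₀ : ∀ y ∈ v₀, ¬ L y) (ht : L t)
    (h : (u₀ ++ t :: u₁).filter (fun z => z = x ∨ L z) =
      (v₀ ++ t :: v₁).filter (fun z => z = x ∨ L z)) :
    u₀.filter (fun z => z = x ∨ L z) = v₀.filter (fun z => z = x ∨ L z) ∧
      u₁.filter (fun z => z = x ∨ L z) = v₁.filter (fun z => z = x ∨ L z) := by
  rw [List.filter_append, List.filter_append, List.filter_cons_of_pos (by simp [ht]),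
    List.filter_cons_of_pos (by simp [ht])] at h
  exact (append_cons_inj_of_notMem_of_notMem
    (fun hm => hu₀ t (List.mem_of_mem_filter hm) ht)
    (fun hm => hv₀ t (List.mem_of_mem_filter hm) ht)).1 h

end Filter

namespace LawsD

variable {M : Type*} [Monoid M]

theorem prod_swap_of_mem_left (h : LawsD M) (f : α → M) (hx : x ∈ p) (hy : y ∈ p)
    (hxy : x ≠ y) : (p.map f).prod * f x * f y = (p.map f).prod * f y * f x := by
  obtain ⟨a, b, c, rfl | rfl⟩ := exists_eq_append_cons_append_cons_of_ne hx hy hxy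
  · simpa [mul_assoc] using congrArg ((a.map f).prod * ·)
      (h.sigma₂ (f x) (f y) (c.map f).prod (b.map f).prod)
  · simpa [mul_assoc] using congrArg ((a.map f).prod * ·)
      (h.sigma₂ (f y) (f x) (c.map f).prod (b.map f).prod).symm

theorem prod_swap_of_mem_right (h : LawsD M) (f : α → M) (hx : x ∈ q) (hy : y ∈ q)
    (hxy : x ≠ y) : f x * f y * (q.map f).prod = f y * f x * (q.map f).prod := by
  obtain ⟨a, b, c, rfl | rfl⟩ := exists_eq_append_cons_append_cons_of_ne hx hy hxy
  · simpa [mul_assoc] using congrArg (· * (c.map f).prod)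
      (h.sigma₁ (f x) (f y) (a.map f).prod (b.map f).prod)
  · simpa [mul_assoc] using congrArg (· * (c.map f).prod)
      (h.sigma₁ (f y) (f x) (a.map f).prod (b.map f).prod).symm

theorem prod_swap_of_mem_of_mem (h : LawsD M) (f : α → M) (hx : x ∈ p) (hy : y ∈ q) :
    (p.map f).prod * f x * f y * (q.map f).prod = (p.map f).prod * f y * f x * (q.map f).prod := by
  obtain ⟨a, b, rfl⟩ := List.append_of_mem hx
  obtain ⟨c, d, rfl⟩ := List.append_of_mem hy
  simpa [mul_assoc] using congrArg ((a.map f).prod * · * (d.map f).prod)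
    (h.gamma₁ (c.map f).prod (f y) (b.map f).prod (f x)).symm

variable [DecidableEq α]

theorem prod_swap (h : LawsD M) (f : α → M) (hx : 2 ≤ (p ++ x :: y :: q).count x)
    (hy : 2 ≤ (p ++ x :: y :: q).count y) :
    ((p ++ x :: y :: q).map f).prod = ((p ++ y :: x :: q).map f).prod := by
  rcases eq_or_ne x y with rfl | hxy
  · rfl
  have hx : x ∈ p ∨ x ∈ q := by
    simp only [← List.count_pos_iff]
    simp only [List.count_append, List.count_cons_self, List.count_cons_of_ne hxy.symm] at hx
    omega
  have hy : y ∈ p ∨ y ∈ q := by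
    simp only [← List.count_pos_iff]
    simp only [List.count_append, List.count_cons_self, List.count_cons_of_ne hxy] at hy
    omega
  simp only [List.map_append, List.map_cons, List.prod_append, List.prod_cons, ← mul_assoc]
  rcases hx with hx | hx <;> rcases hy with hy | hy
  · rw [h.prod_swap_of_mem_left f hx hy hxy]
  · exact h.prod_swap_of_mem_of_mem f hx hy
  · exact (h.prod_swap_of_mem_of_mem f hy hx).symm
  · simpa only [mul_assoc] using
      congrArg ((p.map f).prod * ·) (h.prod_swap_of_mem_right f hx hy hxy)

theorem prod_perm (h : LawsD M) (f : α → M) (hr : r.Perm r')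
    (hcount : ∀ y ∈ r, 2 ≤ (p ++ r ++ s).count y) :
    ((p ++ r ++ s).map f).prod = ((p ++ r' ++ s).map f).prod := by
  induction hr generalizing p with
  | nil => rfl
  | cons x _ ih =>
    have := @ih (p ++ [x]) fun y hy => by simpa using hcount y (List.mem_cons_of_mem x hy)
    simpa using this
  | swap x y l =>
    have := h.prod_swap f (p := p) (q := l ++ s) (x := y) (y := x)
      (by simpa using hcount y (by simp)) (by simpa using hcount x (by simp))
    simpa using this
  | trans hr _ ih₁ ih₂ =>
    refine (ih₁ hcount).trans (ih₂ fun y hy => ?_)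
    rw [← ((hr.append_left p).append_right s).count_eq]
    exact hcount y (hr.mem_iff.2 hy)

theorem sq_mul_prod (h : LawsD M) (f : α → M) (x : α) (l : List α) :
    f x ^ 2 * (l.map f).prod = f x ^ 2 * ((l.filter (· ≠ x)).map f).prod := by
  induction l with
  | nil => rfl
  | cons a l ih =>
    rcases eq_or_ne a x with rfl | ha
    · rw [List.map_cons, List.prod_cons, ← mul_assoc, ← pow_succ, ← h.sq, ih]
      simp
    · rw [List.filter_cons_of_pos (by simpa using ha), List.map_cons, List.prod_cons, List.map_cons,
        List.prod_cons, ← mul_assoc, h.sq_mul_comm, mul_assoc, ih, ← mul_assoc, ← h.sq_mul_comm,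
        mul_assoc]

theorem prod_eq_sq_mul (h : LawsD M) (f : α → M)
    (hr : ∀ y ∈ r, 2 ≤ (p ++ x :: (r ++ x :: q)).count y) :
    ((p ++ x :: (r ++ x :: q)).map f).prod =
      f x ^ 2 * (((p ++ x :: (r ++ x :: q)).filter (· ≠ x)).map f).prod := by
  have move : ((p ++ (x :: (r ++ [x])) ++ q).map f).prod =
      ((p ++ (x :: x :: r) ++ q).map f).prod := by
    refine h.prod_perm f ((List.perm_append_singleton x r).cons x) fun y hy => ?_
    rcases eq_or_ne y x with rfl | hyx
    · simp
      omega
    · simpa using hr y (by simpa [hyx] using hy)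
  calc ((p ++ x :: (r ++ x :: q)).map f).prod
      = ((p ++ (x :: x :: r) ++ q).map f).prod := by simpa using move
    _ = f x ^ 2 * ((p ++ (r ++ q)).map f).prod := by
        simp only [List.map_append, List.map_cons, List.prod_append, List.prod_cons, ← mul_assoc,
          h.sq_mul_comm (f x) (p.map f).prod]
        simp only [pow_two, mul_assoc]
    _ = f x ^ 2 * (((p ++ x :: (r ++ x :: q)).filter (· ≠ x)).map f).prod := by
        rw [h.sq_mul_prod]
        simp

theorem prod_eq_of_filter_eq (h : LawsD M) (f : α → M) (L : α → Prop) [DecidablePred L]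
    {u v : List α} (hcount : ∀ y ∈ u, ¬ L y → 2 ≤ (p ++ u).count y)
    (huv : ∀ x, u.filter (fun z => z = x ∨ L z) = v.filter (fun z => z = x ∨ L z)) :
    ((p ++ u).map f).prod = ((p ++ v).map f).prod := by
  induction hn : u.filter L generalizing p u v with
  | nil =>
    have hL : ∀ y ∈ u, ¬ L y := by simpa [List.filter_eq_nil_iff] using hn
    simpa using h.prod_perm f (s := []) (perm_of_filter_eq huv) fun y hy => by
      simpa using hcount y hy (hL y hy)
  | cons t w ih =>
    obtain ⟨u₀, u₁, rfl, hu₀, hLt, hu₁⟩ := List.filter_eq_cons_iff.1 hn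
    simp only [decide_eq_true_eq] at hu₀ hLt
    have hvu : v.filter L = (u₀ ++ t :: u₁).filter L := by
      have (z : α) : z = t ∨ L z ↔ L z := or_iff_right_of_imp fun hz => hz ▸ hLt
      simpa only [this] using (huv t).symm
    obtain ⟨v₀, v₁, rfl, hv₀, -⟩ := List.filter_eq_cons_iff.1 (hvu.trans hn)
    simp only [decide_eq_true_eq] at hv₀
    have split (x) := filter_split hu₀ hv₀ hLt (huv x)
    have perm : u₀.Perm v₀ := perm_of_filter_eq fun x => (split x).1
    have swap : ((p ++ u₀ ++ t :: u₁).map f).prod = ((p ++ v₀ ++ t :: u₁).map f).prod :=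
      h.prod_perm f perm fun y hy => by
        simpa using hcount y (by simp [hy]) (by simpa using hu₀ y hy)
    have tail : ((p ++ v₀ ++ [t] ++ u₁).map f).prod = ((p ++ v₀ ++ [t] ++ v₁).map f).prod := by
      refine ih (fun y hy hLy => ?_) (fun x => (split x).2) hu₁
      simpa [perm.count_eq] using hcount y (by simp [hy]) hLy
    simpa using swap.trans (by simpa using tail)

end LawsD

end VarietyD

section BrandtMonoid

local notation "𝐚" => (B2.a : BrandtMonoid)
local notation "𝐛" => (B2.b : BrandtMonoid)
local notation "𝐛𝐚" => (B2.ba : BrandtMonoid)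

instance finite_brandtMonoid : Finite BrandtMonoid :=
  have : Finite B2 := Finite.of_surjective ![B2.a, B2.b, B2.ab, B2.ba, B2.zero] fun
    | .a => ⟨0, rfl⟩ | .b => ⟨1, rfl⟩ | .ab => ⟨2, rfl⟩ | .ba => ⟨3, rfl⟩ | .zero => ⟨4, rfl⟩
  inferInstanceAs (Finite (Option B2))

theorem brandt_zero_mul (m : BrandtMonoid) : (B2.zero : BrandtMonoid) * m = B2.zero := by
  rcases m with _ | (_ | _ | _ | _ | _) <;> rfl

theorem brandt_zero_mul_ne_ba (m : BrandtMonoid) : (B2.zero : BrandtMonoid) * m ≠ 𝐛𝐚 := by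
  rw [brandt_zero_mul]
  nofun

theorem brandt_b_mul_a : 𝐛 * 𝐚 = 𝐛𝐚 := rfl

theorem brandt_ba_mul_ne_a (m : BrandtMonoid) : 𝐛𝐚 * m ≠ 𝐚 := by
  intro h
  rcases m with _ | (_ | _ | _ | _ | _) <;> cases h

theorem brandt_a_pow (n : ℕ) : 𝐚 ^ (n + 2) = (B2.zero : BrandtMonoid) := by
  induction n with
  | zero => rfl
  | succ n ih => rw [pow_succ, ih]; rfl

theorem eq_one_of_brandt_a_pow_eq : ∀ {n : ℕ}, 𝐚 ^ n = 𝐚 → n = 1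
  | 0, h => nomatch h
  | 1, _ => rfl
  | n + 2, h => by rw [brandt_a_pow] at h; cases h

theorem brandt_a_mul_ba_pow (n : ℕ) : 𝐚 * 𝐛𝐚 ^ n = 𝐚 := by
  induction n with
  | zero => rfl
  | succ n ih => rw [pow_succ, ← mul_assoc, ih]; rfl

variable {u v w l k : List ℕ} {x : ℕ}

theorem count_eq_one_of_holds_brandt (h : Holds BrandtMonoid u v) (hx : u.count x = 1) :
    v.count x = 1 :=
  eq_one_of_brandt_a_pow_eq <| by
    simpa only [prod_map_update_one, hx, pow_one] using (h (Function.update 1 x 𝐚)).symm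

theorem eq_of_holds_brandt_of_nodup (h : Holds BrandtMonoid u v) (hu : u.Nodup) (hv : v.Nodup) :
    u = v := by
  have subset {u v : List ℕ} (h : Holds BrandtMonoid u v) (hu : u.Nodup) : u ⊆ v := fun x hx =>
    List.count_pos_iff.1 <|
      (count_eq_one_of_holds_brandt h (List.count_eq_one_of_mem hu hx)).symm ▸ one_pos
  induction u generalizing v with
  | nil => exact (List.subset_nil.1 (subset h.symm hv)).symm
  | cons a u ih =>
    rcases v with - | ⟨b, v⟩
    · exact List.subset_nil.1 (subset h hu)
    rw [List.nodup_cons] at hu hv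
    obtain rfl : a = b := by
      by_contra hab
      have prod_eq := h (Function.update (Function.update 1 b 𝐛𝐚) a 𝐚)
      rw [List.map_cons, List.map_cons, map_update_of_notMem _ _ hu.1, List.prod_cons,
        List.prod_cons, prod_map_update_one, Function.update_self,
        Function.update_of_ne (Ne.symm hab), Function.update_self, brandt_a_mul_ba_pow] at prod_eq
      exact brandt_ba_mul_ne_a _ prod_eq.symm
    have filter_cons {l : List ℕ} (hl : a ∉ l) : (a :: l).filter (· ≠ a) = l := by
      rw [List.filter_cons_of_neg (by simp), List.filter_eq_self]
      exact fun z hz => by simpa using ne_of_mem_of_not_mem hz hl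
    have tail := h.filter (· ≠ a)
    rw [filter_cons hu.1, filter_cons hv.1] at tail
    rw [ih tail hu.2 hv.2]

/-- The element of the Brandt monoid that records whether the word `l` starts with the letter
`x`. -/
def startLabel (x : ℕ) (l : List ℕ) : BrandtMonoid :=
  if l.head? = some x then 𝐛 else 𝐛𝐚

/-- The substitution `f` of elements of the Brandt monoid for letters takes `x` to `a` and every
other letter of `l` to the label of the part of `l` that follows it. -/
structure IsLabelling (x : ℕ) (f : ℕ → BrandtMonoid) (l : List ℕ) : Prop where
  apply_self : f x = 𝐚
  apply_eq : ∀ {p t q}, l = p ++ t :: q → t ≠ x → f t = startLabel x q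

theorem startLabel_cons_self : startLabel x (x :: l) = 𝐛 :=
  if_pos rfl

theorem startLabel_cons_of_ne {t : ℕ} (ht : t ≠ x) : startLabel x (t :: l) = 𝐛𝐚 :=
  if_neg (by simpa using ht)

theorem startLabel_of_not_infix (h : ¬ [x, x] <:+: x :: l) : startLabel x l = 𝐛𝐚 := by
  refine if_neg fun hl => h ?_
  obtain ⟨m, rfl⟩ := List.head?_eq_some_iff.1 hl
  exact ⟨[], m, rfl⟩

theorem ba_mul_startLabel : 𝐛𝐚 * startLabel x l = startLabel x l := by
  rw [startLabel]
  split_ifs <;> rfl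

theorem b_mul_startLabel : 𝐛 * startLabel x l = (B2.zero : BrandtMonoid) := by
  rw [startLabel]
  split_ifs <;> rfl

namespace IsLabelling

variable {f : ℕ → BrandtMonoid} {t : ℕ}

theorem apply_head (h : IsLabelling x f (t :: l)) (ht : t ≠ x) : f t = startLabel x l :=
  h.apply_eq (p := []) rfl ht

theorem tail (h : IsLabelling x f (t :: l)) : IsLabelling x f l :=
  ⟨h.apply_self, fun {p _ _} hl => h.apply_eq (p := t :: p) (by simp [hl])⟩

theorem cons_self (h : IsLabelling x f l) : IsLabelling x f (x :: l) := by
  refine ⟨h.apply_self, fun {p s q} hp hs => ?_⟩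
  rcases p with - | ⟨c, p⟩
  · exact absurd (List.cons_eq_cons.1 hp).1.symm hs
  · exact h.apply_eq (List.cons_eq_cons.1 hp).2 hs

theorem update_cons (h : IsLabelling x f l) (htx : t ≠ x) (htl : t ∉ l) :
    IsLabelling x (Function.update f t (startLabel x l)) (t :: l) := by
  refine ⟨by rw [Function.update_of_ne htx.symm, h.apply_self], fun {p s q} hp hs => ?_⟩
  rcases p with - | ⟨c, p⟩
  · obtain ⟨rfl, rfl⟩ := List.cons_eq_cons.1 hp
    exact Function.update_self ..
  · obtain ⟨rfl, rfl⟩ := List.cons_eq_cons.1 hp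
    rw [Function.update_of_ne fun hst => htl (by simp [← hst]), h.apply_eq rfl hs]

theorem startLabel_mul_prod (h : IsLabelling x f l) (hxx : ¬ [x, x] <:+: l) :
    startLabel x l * (l.map f).prod = 𝐛𝐚 := by
  induction l with
  | nil => rfl
  | cons t l ih =>
    have hl : ¬ [x, x] <:+: l := fun hc => hxx (hc.trans (List.suffix_cons t l).isInfix)
    rw [List.map_cons, List.prod_cons, ← mul_assoc]
    rcases eq_or_ne t x with rfl | ht
    · rw [startLabel_cons_self, h.apply_self, ← ih h.tail hl, startLabel_of_not_infix hxx]
      rfl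
    · rw [startLabel_cons_of_ne ht, h.apply_head ht, ba_mul_startLabel, ih h.tail hl]

theorem b_mul_apply (h : IsLabelling x f l) (ht : t ∈ l) (htx : t ≠ x) :
    𝐛 * f t = (B2.zero : BrandtMonoid) := by
  obtain ⟨p, q, rfl⟩ := List.append_of_mem ht
  rw [h.apply_eq rfl htx, b_mul_startLabel]

theorem ba_mul_prod_cons_self_ne (h : IsLabelling x f l) (k : List ℕ) :
    𝐛𝐚 * ((x :: k).map f).prod ≠ 𝐛𝐚 := by
  rw [List.map_cons, List.prod_cons, h.apply_self, ← mul_assoc]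
  exact brandt_zero_mul_ne_ba _

theorem eq_of_startLabel_mul_prod (h : IsLabelling x f l) (hxx : ¬ [x, x] <:+: l)
    (hlk : l.filter (· ≠ x) = k.filter (· ≠ x)) (hk : startLabel x l * (k.map f).prod = 𝐛𝐚) :
    l = k := by
  induction l generalizing k with
  | nil =>
    rcases k with - | ⟨c, k⟩
    · rfl
    obtain rfl : c = x := by by_contra hc; simp [hc] at hlk
    exact absurd hk (h.ba_mul_prod_cons_self_ne k)
  | cons t l ih =>
    have hl : ¬ [x, x] <:+: l := fun hc => hxx (hc.trans (List.suffix_cons t l).isInfix)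
    rcases eq_or_ne t x with rfl | ht <;> rcases k with - | ⟨c, k⟩
    · rw [startLabel_cons_self] at hk
      cases hk
    · rw [startLabel_cons_self, List.map_cons, List.prod_cons, ← mul_assoc] at hk
      rcases eq_or_ne c t with rfl | hc
      · rw [h.apply_self, brandt_b_mul_a] at hk
        rw [ih h.tail hl (by simpa using hlk) (by rwa [startLabel_of_not_infix hxx])]
      · have hcl : c ∈ (t :: l).filter (· ≠ t) := by
          rw [hlk]
          simp [hc]
        rw [h.b_mul_apply (List.mem_of_mem_filter hcl) hc] at hk
        exact absurd hk (brandt_zero_mul_ne_ba _)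
    · simp [ht] at hlk
    · rw [startLabel_cons_of_ne ht] at hk
      have hc : c ≠ x := by rintro rfl; exact h.ba_mul_prod_cons_self_ne k hk
      obtain ⟨rfl, htail⟩ : t = c ∧ l.filter (· ≠ x) = k.filter (· ≠ x) := by
        simpa [ht, hc] using hlk
      rw [List.map_cons, List.prod_cons, ← mul_assoc, h.apply_head ht, ba_mul_startLabel] at hk
      rw [ih h.tail hl htail hk]

end IsLabelling

theorem exists_isLabelling (hl : (l.filter (· ≠ x)).Nodup) : ∃ f, IsLabelling x f l := by
  induction l with
  | nil => exact ⟨fun _ => 𝐚, rfl, by simp⟩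
  | cons t l ih =>
    rcases eq_or_ne t x with rfl | ht
    · obtain ⟨f, hf⟩ := ih (by simpa using hl)
      exact ⟨f, hf.cons_self⟩
    · rw [List.filter_cons_of_pos (by simpa using ht), List.nodup_cons] at hl
      obtain ⟨f, hf⟩ := ih hl.2
      exact ⟨_, hf.update_cons ht fun htl => hl.1 (by simp [htl, ht])⟩

theorem eq_of_holds_brandt_of_not_infix (h : Holds BrandtMonoid l k)
    (hl : (l.filter (· ≠ x)).Nodup) (hk : (k.filter (· ≠ x)).Nodup) (hxx : ¬ [x, x] <:+: l) :
    l = k := by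
  obtain ⟨f, hf⟩ := exists_isLabelling hl
  refine hf.eq_of_startLabel_mul_prod hxx (eq_of_holds_brandt_of_nodup (h.filter _) hl hk) ?_
  rw [← h f, hf.startLabel_mul_prod hxx]

/-- The restriction of the word `w` to the letter `x` and its linear letters, that is, those that
occur just once. -/
def linearFilter (x : ℕ) (w : List ℕ) : List ℕ :=
  w.filter fun z => z = x ∨ w.count z = 1

theorem nodup_filter_linearFilter (x : ℕ) (w : List ℕ) :
    ((linearFilter x w).filter (· ≠ x)).Nodup := by
  rw [linearFilter, List.filter_filter, List.nodup_iff_count_le_one]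
  intro y
  by_contra! hy
  have hmem := List.count_pos_iff.1 (one_pos.trans hy)
  have hle := (List.filter_sublist (l := w)
    (p := fun z => decide (z ≠ x) && decide (z = x ∨ w.count z = 1))).count_le y
  simp only [List.mem_filter, Bool.and_eq_true, decide_eq_true_eq] at hmem
  have := hmem.2.2.resolve_left hmem.2.1
  omega

theorem count_eq_one_iff_of_holds_brandt (h : Holds BrandtMonoid u v) (x : ℕ) :
    u.count x = 1 ↔ v.count x = 1 :=
  ⟨count_eq_one_of_holds_brandt h, count_eq_one_of_holds_brandt h.symm⟩

theorem linearFilter_eq_of_not_infix (h : Holds BrandtMonoid u v)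
    (hxx : ¬ [x, x] <:+: linearFilter x u) : linearFilter x u = linearFilter x v := by
  refine eq_of_holds_brandt_of_not_infix ?_ (nodup_filter_linearFilter x u)
    (nodup_filter_linearFilter x v) hxx
  simpa only [linearFilter, ← count_eq_one_iff_of_holds_brandt h] using h.filter _

variable {M : Type*} [Monoid M]

theorem mem_of_infix_linearFilter (h : [x, x] <:+: linearFilter x w) : x ∈ w :=
  List.mem_of_mem_filter (h.subset List.mem_cons_self)

theorem LawsD.prod_eq_sq_mul_of_infix (hM : LawsD M) (f : ℕ → M)
    (h : [x, x] <:+: linearFilter x w) :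
    (w.map f).prod = f x ^ 2 * ((w.filter (· ≠ x)).map f).prod := by
  obtain ⟨c, d, hcd⟩ := h
  rw [List.append_assoc] at hcd
  obtain ⟨p, s, rfl, -, hs⟩ := List.filter_eq_append_iff.1 hcd.symm
  obtain ⟨p', s', rfl, -, -, hs'⟩ := List.filter_eq_cons_iff.1 hs
  obtain ⟨r, q, rfl, hr, -, -⟩ := List.filter_eq_cons_iff.1 hs'
  rw [← List.append_assoc] at hr ⊢
  refine hM.prod_eq_sq_mul f fun y hy => ?_
  have hlinear := hr y hy
  have hpos : 0 < (p ++ p' ++ x :: (r ++ x :: q)).count y := List.count_pos_iff.2 (by simp [hy])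
  simp only [decide_eq_true_eq, not_or] at hlinear
  omega

theorem LawsD.holds_of_linearFilter_eq (hM : LawsD M) (h : Holds BrandtMonoid u v)
    (huv : ∀ x, linearFilter x u = linearFilter x v) : Holds M u v := fun f => by
  refine hM.prod_eq_of_filter_eq f (u.count · = 1) (p := []) (fun y hy hlin => ?_) fun x => ?_
  · have := List.count_pos_iff.2 hy
    rw [List.nil_append]
    omega
  · simpa only [linearFilter, ← count_eq_one_iff_of_holds_brandt h] using huv x

theorem LawsD.holds_of_holds_brandt (hM : LawsD M) (h : Holds BrandtMonoid u v) :
    Holds M u v := by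
  induction hn : u.length using Nat.strong_induction_on generalizing u v with
  | _ n ih =>
  by_cases hxx : ∃ x, [x, x] <:+: linearFilter x u
  · obtain ⟨x, hu⟩ := hxx
    have hv : [x, x] <:+: linearFilter x v := by
      by_contra hv
      exact hv (linearFilter_eq_of_not_infix h.symm hv ▸ hu)
    have length_lt : (u.filter (· ≠ x)).length < n :=
      hn ▸ List.length_filter_lt_length_iff_exists.2 ⟨x, mem_of_infix_linearFilter hu, by simp⟩
    intro f
    rw [hM.prod_eq_sq_mul_of_infix f hu, hM.prod_eq_sq_mul_of_infix f hv,
      ih _ length_lt (h.filter (· ≠ x)) rfl f]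
  · push Not at hxx
    exact hM.holds_of_linearFilter_eq h fun x => linearFilter_eq_of_not_infix h (hxx x)

end BrandtMonoid

theorem varietyD_le : varietyD.{u} ≤ Variety.generatedBy (ULift.{u} BrandtMonoid) :=
  Variety.le_generatedBy_ulift_iff.2 fun _ _ hN _ _ =>
    (varietyD_contains_iff.1 hN).holds_of_holds_brandt

/-! ### Factor monoids and isoterms -/

section FactorMonoid

variable {w u v : List ℕ} {k x : ℕ}

/-- The congruence on words that identifies all words that are not factors of `w`. -/
def factorCon (w : List ℕ) : Con (FreeMonoid ℕ) where
  r u v := u = v ∨ ¬ u.toList <:+: w ∧ ¬ v.toList <:+: w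
  iseqv := by
    refine ⟨fun _ => Or.inl rfl, ?_, ?_⟩
    · rintro u v (rfl | h)
      exacts [Or.inl rfl, Or.inr h.symm]
    · rintro u v x (rfl | h) (rfl | h')
      exacts [Or.inl rfl, Or.inr h', Or.inr h, Or.inr ⟨h.1, h'.2⟩]
  mul' := by
    have left {u v : FreeMonoid ℕ} (h : ¬ u.toList <:+: w) : ¬ (u * v).toList <:+: w :=
      fun hc => h ((List.prefix_append _ _).isInfix.trans hc)
    have right {u v : FreeMonoid ℕ} (h : ¬ v.toList <:+: w) : ¬ (u * v).toList <:+: w :=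
      fun hc => h ((List.suffix_append _ _).isInfix.trans hc)
    rintro u v x y (rfl | h) (rfl | h')
    exacts [Or.inl rfl, Or.inr ⟨right h'.1, right h'.2⟩, Or.inr ⟨left h.1, left h.2⟩,
      Or.inr ⟨left h.1, left h.2⟩]

/-- The monoid of factors of the word `w` with a zero adjoined, in which a product that is not a
factor of `w` is zero. -/
abbrev FactorMonoid (w : List ℕ) : Type := (factorCon w).Quotient

theorem prod_map_flatMap {α β M : Type*} [Monoid M] (f : β → M) (g : α → List β) (l : List α) :
    ((l.flatMap g).map f).prod = (l.map fun a => ((g a).map f).prod).prod := by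
  simp [List.flatMap, List.prod_flatten, Function.comp_def]

theorem holds_factorMonoid_iff : Holds (FactorMonoid w) u v ↔
    ∀ g : ℕ → List ℕ, u.flatMap g = v.flatMap g ∨
      ¬ u.flatMap g <:+: w ∧ ¬ v.flatMap g <:+: w := by
  have prod_mk (g : ℕ → List ℕ) (l : List ℕ) :
      (l.map fun z => (factorCon w).mk' (FreeMonoid.ofList (g z))).prod =
        (factorCon w).mk' (FreeMonoid.ofList (l.flatMap g)) := by
    rw [List.flatMap, FreeMonoid.ofList_flatten, map_list_prod, List.map_map, List.map_map]
    rfl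
  refine ⟨fun h g => ?_, fun h f => ?_⟩
  · have := h fun z => (factorCon w).mk' (FreeMonoid.ofList (g z))
    rw [prod_mk, prod_mk] at this
    exact (factorCon w).eq.1 this
  · choose g hg using fun z => (factorCon w).mk'_surjective (f z)
    obtain rfl : (fun z => (factorCon w).mk' (FreeMonoid.ofList (g z).toList)) = f := funext hg
    rw [prod_mk, prod_mk]
    exact (factorCon w).eq.2 (h fun z => (g z).toList)

theorem not_holds_factorMonoid (h : v ≠ w) : ¬ Holds (FactorMonoid w) w v := fun hc => by
  have := holds_factorMonoid_iff.1 hc (fun z => [z])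
  simp only [List.flatMap_singleton'] at this
  exact this.elim (fun e => h e.symm) fun e => e.1 List.infix_rfl

theorem mul_count_le_count_flatMap (g : ℕ → List ℕ) (x c : ℕ) (u : List ℕ) :
    u.count x * (g x).count c ≤ (u.flatMap g).count c := by
  have hsub : (List.replicate (u.count x) x).Sublist u := List.replicate_sublist_iff.2 le_rfl
  have := (hsub.map (List.count c ∘ g)).sum_le_sum (by simp)
  rwa [List.map_replicate, List.sum_replicate, smul_eq_mul, ← List.count_flatMap] at this

theorem notMem_of_flatMap_infix {c : ℕ} {g : ℕ → List ℕ} (hw : w.count c < k)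
    (hu : k ≤ u.count x) (h : u.flatMap g <:+: w) : c ∉ g x := fun hc => by
  have := calc
    k * 1 ≤ u.count x * (g x).count c := Nat.mul_le_mul hu (List.count_pos_iff.2 hc)
    _ ≤ (u.flatMap g).count c := mul_count_le_count_flatMap g x c u
    _ ≤ w.count c := h.sublist.count_le c
  omega

theorem flatMap_filter_ne {α β : Type*} [DecidableEq α] {x : α} {g : α → List β} (hx : g x = [])
    (l : List α) : (l.filter (· ≠ x)).flatMap g = l.flatMap g := by
  induction l with
  | nil => rfl
  | cons a l ih => by_cases ha : a = x <;> simp_all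

theorem holds_factorMonoid_of_filter_eq (hw : ∀ c, w.count c < k) (hu : k ≤ u.count x)
    (hv : k ≤ v.count x) (huv : u.filter (· ≠ x) = v.filter (· ≠ x)) :
    Holds (FactorMonoid w) u v := by
  refine holds_factorMonoid_iff.2 fun g => ?_
  by_cases hg : g x = []
  · rw [← flatMap_filter_ne hg u, huv, flatMap_filter_ne hg]
    exact Or.inl rfl
  · obtain ⟨c, hc⟩ := List.exists_mem_of_ne_nil _ hg
    exact Or.inr ⟨fun h => notMem_of_flatMap_infix (hw c) hu h hc,
      fun h => notMem_of_flatMap_infix (hw c) hv h hc⟩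

theorem append_comm_of_forall_eq {α : Type*} {l l' : List α} {a : α} (hl : ∀ b ∈ l, b = a)
    (hl' : ∀ b ∈ l', b = a) : l ++ l' = l' ++ l := by
  rw [List.eq_replicate_of_mem hl, List.eq_replicate_of_mem hl', List.replicate_append_replicate,
    List.replicate_append_replicate, add_comm]

theorem holds_factorMonoid_of_comm {y c : ℕ} (hw : ∀ z ≠ c, w.count z < k)
    (hu : k ≤ u.count x ∧ k ≤ u.count y) (hv : k ≤ v.count x ∧ k ≤ v.count y)
    (huv : ∀ g : ℕ → List ℕ, g x ++ g y = g y ++ g x → u.flatMap g = v.flatMap g) :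
    Holds (FactorMonoid w) u v := by
  refine holds_factorMonoid_iff.2 fun g => or_iff_not_imp_left.2 fun hne => ?_
  have not_infix {l : List ℕ} (hl : k ≤ l.count x ∧ k ≤ l.count y) : ¬ l.flatMap g <:+: w := by
    intro h
    have eq_of_mem {z : ℕ} (hz : k ≤ l.count z) (b : ℕ) (hb : b ∈ g z) : b = c :=
      by_contra fun hbc => notMem_of_flatMap_infix (hw b hbc) hz h hb
    exact hne (huv g (append_comm_of_forall_eq (eq_of_mem hl.1) (eq_of_mem hl.2)))
  exact ⟨not_infix hu, not_infix hv⟩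

end FactorMonoid

namespace Variety

variable {V : Variety.{u}} {u v w : List ℕ} {x : ℕ}

theorem Entails.flatMap (h : V.Entails u v) (g : ℕ → List ℕ) :
    V.Entails (u.flatMap g) (v.flatMap g) := fun M _ hM f => by
  rw [prod_map_flatMap, prod_map_flatMap, h M hM]

theorem Entails.append (h : V.Entails u v) (p q : List ℕ) :
    V.Entails (p ++ u ++ q) (p ++ v ++ q) := fun M _ hM f => by
  simp only [List.map_append, List.prod_append, h M hM f]

/-- The word `w` is an isoterm for `V`: it forms no nontrivial identity of `V`. -/
def IsIsoterm (V : Variety.{u}) (w : List ℕ) : Prop := ∀ v, V.Entails w v → v = w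

theorem not_isIsoterm : ¬ V.IsIsoterm w ↔ ∃ v, V.Entails w v ∧ v ≠ w := by
  simp only [IsIsoterm, not_forall, exists_prop]

theorem IsIsoterm.of_append {p q : List ℕ} (h : V.IsIsoterm (p ++ w ++ q)) : V.IsIsoterm w :=
  fun _ hv => List.append_cancel_left (List.append_cancel_right (h _ (hv.append p q)))

theorem IsIsoterm.eq_of_infix (h : V.IsIsoterm w) (hu : u <:+: w) (huv : V.Entails u v) :
    v = u := by
  obtain ⟨p, q, rfl⟩ := hu
  exact h.of_append _ huv

theorem IsIsoterm.containsLift (h : V.IsIsoterm w) : V.ContainsLift (FactorMonoid w) :=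
  containsLift_iff.2 fun _ _ huv => holds_factorMonoid_iff.2 fun g =>
    or_iff_not_imp_left.2 fun hne => ⟨fun hu => hne (h.eq_of_infix hu (huv.flatMap g)).symm,
      fun hv => hne (h.eq_of_infix hv (huv.flatMap g).symm)⟩

theorem Entails.mem (h : V.Entails u v) (hV : ¬ V.IsGroupVariety) (hx : x ∈ u) : x ∈ v := by
  by_contra hc
  refine hV fun M _ hM m => IsUnit.of_pow_eq_one ?_ (List.count_pos_iff.2 hx).ne'
  simpa only [prod_map_update_one, List.count_eq_zero.2 hc, pow_zero] using
    h M hM (Function.update 1 x m)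

theorem Entails.mem_iff (h : V.Entails u v) (hV : ¬ V.IsGroupVariety) : x ∈ u ↔ x ∈ v :=
  ⟨h.mem hV, h.symm.mem hV⟩

end Variety

/-! ### Aperiodicity -/

theorem holds_of_pow_count {M : Type*} [CommMonoid M] {u v : List ℕ}
    (h : ∀ (z : ℕ) (m : M), m ^ u.count z = m ^ v.count z) : Holds M u v := fun f => by
  have prod_eq {l : List ℕ} {s : Finset ℕ} (hs : l.toFinset ⊆ s) :
      (l.map f).prod = ∏ z ∈ s, f z ^ l.count z := by
    rw [Finset.prod_list_map_count]
    refine Finset.prod_subset hs fun z _ hz => ?_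
    rw [List.count_eq_zero.2 (by simpa using hz), pow_zero]
  rw [prod_eq (s := u.toFinset ∪ v.toFinset) Finset.subset_union_left,
    prod_eq (s := u.toFinset ∪ v.toFinset) Finset.subset_union_right]
  exact Finset.prod_congr rfl fun z _ => h z _

theorem rightAbsorbs_of_pow_eq {M : Type*} [CommMonoid M] {n : ℕ}
    (h : ∀ m : M, m ^ n = m ^ (n + 1)) : RightAbsorbs n M := by
  intro f w x hx
  obtain ⟨l, hl⟩ := (List.replicate_sublist_iff.2 hx).exists_perm_append
  rw [(hl.map f).prod_eq]
  simp only [List.map_append, List.map_replicate, List.prod_append, List.prod_replicate]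
  rw [mul_right_comm, ← pow_succ, ← h]

namespace Variety

variable {V : Variety.{u}} {i j k l n : ℕ}

/-- The power law `x ^ i ≈ x ^ j` holds in `V`. -/
def EntailsPow (V : Variety.{u}) (i j : ℕ) : Prop :=
  ∀ (M : Type u) [Monoid M], V.Contains M → ∀ m : M, m ^ i = m ^ j

theorem Entails.entailsPow {u v : List ℕ} (h : V.Entails u v) (x : ℕ) :
    V.EntailsPow (u.count x) (v.count x) := fun M _ hM m => by
  simpa only [prod_map_update_one] using h M hM (Function.update 1 x m)

theorem EntailsPow.symm (h : V.EntailsPow i j) : V.EntailsPow j i :=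
  fun M _ hM m => (h M hM m).symm

theorem EntailsPow.trans (h : V.EntailsPow i j) (h' : V.EntailsPow j k) : V.EntailsPow i k :=
  fun M _ hM m => (h M hM m).trans (h' M hM m)

theorem EntailsPow.add (h : V.EntailsPow i j) (h' : V.EntailsPow k l) :
    V.EntailsPow (i + k) (j + l) := fun M _ hM m => by
  rw [pow_add, pow_add, h M hM, h' M hM]

theorem EntailsPow.refl (i : ℕ) : V.EntailsPow i i := fun _ _ _ _ => rfl

theorem EntailsPow.add_mul (h : V.EntailsPow i (i + j)) (k : ℕ) : V.EntailsPow i (i + k * j) := by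
  induction k with
  | zero => simpa using EntailsPow.refl i
  | succ k ih =>
    refine h.trans ?_
    convert ih.add (.refl j) using 1
    ring

theorem EntailsPow.of_le (h : V.EntailsPow n (n + 1)) (hi : n ≤ i) (hj : n ≤ j) :
    V.EntailsPow i j := by
  obtain ⟨i, rfl⟩ := Nat.exists_eq_add_of_le hi
  obtain ⟨j, rfl⟩ := Nat.exists_eq_add_of_le hj
  simpa using (h.add_mul i).symm.trans (h.add_mul j)

theorem EntailsPow.succ_of_lt (hn : V.EntailsPow n (n + 1)) (hij : i < j)
    (h : V.EntailsPow i j) : V.EntailsPow i (i + 1) := by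
  obtain ⟨d, rfl⟩ := Nat.exists_eq_add_of_lt hij
  have hd : n ≤ n * (d + 1) := Nat.le_mul_of_pos_right n d.succ_pos
  have := EntailsPow.add_mul (j := d + 1) h n
  exact (this.trans (hn.of_le (by omega) (by omega))).trans (this.add (.refl 1)).symm

theorem IsChainVariety.not_containsLift_zmod (hc : V.IsChainVariety) (hg : ¬ V.IsGroupVariety)
    {p : ℕ} (hp : 1 < p) : ¬ V.ContainsLift (Multiplicative (ZMod p)) := by
  intro hZ
  have hnil : V.IsIsoterm [] := fun v hv =>
    List.eq_nil_iff_forall_not_mem.2 fun x hx => by simpa using hv.symm.mem hg hx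
  have : Fact (1 < p) := ⟨hp⟩
  refine hc.not_separated hnil.containsLift hZ (u := [0, 0]) (v := [0]) (u' := [])
    (v' := List.replicate p 0) ?_ ?_ ?_ ?_
  · exact holds_factorMonoid_of_filter_eq (k := 1) (x := 0) (by simp) (by simp) (by simp) (by simp)
  · intro h
    simpa using h fun _ => Multiplicative.ofAdd (1 : ZMod p)
  · intro f
    apply Multiplicative.toAdd.injective
    simp
  · exact not_holds_factorMonoid (by simpa using (zero_lt_one.trans hp).ne')

theorem IsChainVariety.exists_entailsPow_not_modEq (hc : V.IsChainVariety)
    (hg : ¬ V.IsGroupVariety) {p : ℕ} (hp : 1 < p) :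
    ∃ i j, V.EntailsPow i j ∧ ¬ i ≡ j [MOD p] := by
  by_contra! hmod
  refine hc.not_containsLift_zmod hg hp (containsLift_iff.2 fun u v huv =>
    holds_of_pow_count fun z m => Multiplicative.toAdd.injective ?_)
  have := (ZMod.natCast_eq_natCast_iff _ _ _).2 (hmod _ _ (huv.entailsPow z))
  simp only [toAdd_pow, nsmul_eq_mul, this]

/-- The subgroup of all differences `j - i` of exponents in power laws `x ^ i ≈ x ^ j` of `V`. -/
def powDifferences (V : Variety.{u}) : AddSubgroup ℤ where
  carrier := {d | ∃ i j : ℕ, V.EntailsPow i j ∧ (j - i : ℤ) = d}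
  zero_mem' := ⟨0, 0, .refl 0, by simp⟩
  add_mem' := by
    rintro _ _ ⟨i, j, h, rfl⟩ ⟨k, l, h', rfl⟩
    exact ⟨_, _, h.add h', by push_cast; ring⟩
  neg_mem' := by
    rintro _ ⟨i, j, h, rfl⟩
    exact ⟨j, i, h.symm, by ring⟩

theorem IsChainVariety.exists_entailsPow_succ (hc : V.IsChainVariety) (hg : ¬ V.IsGroupVariety) :
    ∃ n, V.EntailsPow n (n + 1) := by
  obtain ⟨a, ha⟩ := Int.subgroup_cyclic V.powDifferences
  have dvd_of_entailsPow {i j : ℕ} (h : V.EntailsPow i j) : a ∣ j - i := by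
    rw [← Int.mem_zmultiples_iff, AddSubgroup.zmultiples_eq_closure, ← ha]
    exact ⟨i, j, h, rfl⟩
  have ha1 : a.natAbs = 1 := by
    by_contra hne
    obtain ⟨p, hp, hpa⟩ : ∃ p : ℕ, 1 < p ∧ (p : ℤ) ∣ a := by
      rcases eq_or_ne a 0 with rfl | h0
      · exact ⟨2, one_lt_two, dvd_zero _⟩
      · exact ⟨a.natAbs, by omega, Int.natAbs_dvd.2 dvd_rfl⟩
    obtain ⟨i, j, h, hij⟩ := hc.exists_entailsPow_not_modEq hg hp
    exact hij ((Nat.modEq_iff_dvd).2 (hpa.trans (dvd_of_entailsPow h)))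
  obtain ⟨n, j, h, hj⟩ : (1 : ℤ) ∈ V.powDifferences := by
    rw [ha, ← AddSubgroup.zmultiples_eq_closure, Int.mem_zmultiples_iff]
    exact (Int.isUnit_iff_natAbs_eq.2 ha1).dvd
  obtain rfl : j = n + 1 := by omega
  exact ⟨n, h⟩

end Variety

/-! ### Bands -/

section Bands

/-- The two-element right zero semigroup. -/
def RightZero : Type := Bool

instance : Semigroup RightZero where
  mul _ y := y
  mul_assoc _ _ _ := rfl

/-- The two-element right zero semigroup with an identity element adjoined. -/
abbrev RightZeroMonoid : Type := WithOne RightZero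

theorem RightZeroMonoid.mul_eq_right (m : RightZeroMonoid) {n : RightZeroMonoid} (hn : n ≠ 1) :
    m * n = n := by
  cases n with
  | none => exact absurd rfl hn
  | some n => cases m <;> rfl

theorem RightZeroMonoid.mul_mul_self (m n : RightZeroMonoid) : m * n * m = n * m := by
  by_cases hm : m = 1
  · simp [hm]
  · rw [mul_eq_right _ hm, mul_eq_right _ hm]

theorem mul_prod_mul_eq_mul {M : Type*} [Monoid M] (hM : ∀ m : M, m * m = m) {a b : M}
    {l : List M} (hl : ∀ m ∈ l, m = a ∨ m = b) : b * l.prod * a = b * a := by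
  have cases_prod : b * l.prod = b ∨ b * l.prod = b * a ∨ b * l.prod = b * a * b := by
    induction l using List.reverseRecOn with
    | nil => simp
    | append_singleton l m ih =>
      rw [List.prod_append, List.prod_singleton, ← mul_assoc]
      have hbaba : b * a * b * a = b * a := by simpa [mul_assoc] using hM (b * a)
      rcases ih fun m hm => hl m (by simp [hm]) with e | e | e <;>
        rcases hl m (by simp) with rfl | rfl <;> simp [e, hM, hbaba, mul_assoc _ m m]
  rcases cases_prod with e | e | e <;> rw [e]
  · rw [mul_assoc, hM]
  · simpa [mul_assoc] using hM (b * a)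

namespace Variety

variable {V : Variety.{u}} {u v : List ℕ}

theorem Entails.filter (h : V.Entails u v) (p : ℕ → Prop) [DecidablePred p] :
    V.Entails (u.filter p) (v.filter p) :=
  fun M _ hM => (h M hM).filter p

/-- All members of the variety `V` are commutative. -/
def IsCommutative (V : Variety.{u}) : Prop :=
  ∀ (M : Type u) [Monoid M], V.Contains M → ∀ a b : M, a * b = b * a

/-- All members of the variety `V` are bands. -/
def IsBand (V : Variety.{u}) : Prop :=
  ∀ (M : Type u) [Monoid M], V.Contains M → ∀ m : M, m * m = m

theorem IsCommutative.of_op (hV : V.op.IsCommutative) : V.IsCommutative := fun _ _ hM a b =>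
  MulOpposite.op_injective
    (hV _ (op_contains_mulOpposite.2 hM) (MulOpposite.op b) (MulOpposite.op a))

theorem IsBand.of_op (hV : V.op.IsBand) : V.IsBand := fun _ _ hM m =>
  MulOpposite.op_injective (hV _ (op_contains_mulOpposite.2 hM) (MulOpposite.op m))

theorem IsBand.op (hV : V.IsBand) : V.op.IsBand := IsBand.of_op (by rwa [op_op])

theorem exists_entails_concat_of_not_containsLift (hg : ¬ V.IsGroupVariety)
    (hV : ¬ V.ContainsLift RightZeroMonoid) :
    ∃ p q x y, x ≠ y ∧ V.Entails (p ++ [x]) (q ++ [y]) := by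
  classical
  simp only [containsLift_iff, Holds, not_forall] at hV
  obtain ⟨u, v, huv, f, hf⟩ := hV
  have prod_filter (l : List ℕ) : ((l.filter (f · ≠ 1)).map f).prod = (l.map f).prod := by
    rw [prod_map_filter]
    congr! 3 with z
    exact ite_eq_left_iff.2 fun h => (not_not.1 h).symm
  have prod_concat {p : List ℕ} {x : ℕ} (hx : f x ≠ 1) : ((p ++ [x]).map f).prod = f x := by
    rw [List.map_append, List.prod_append, List.map_singleton, List.prod_singleton,
      RightZeroMonoid.mul_eq_right _ hx]
  have huv' := huv.filter (f · ≠ 1)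
  have ne_one {l l' : List ℕ} {z : ℕ} (hl : l.filter (f · ≠ 1) = l' ++ [z]) : f z ≠ 1 := by
    have : z ∈ l.filter (f · ≠ 1) := hl ▸ List.mem_append_right _ (List.mem_singleton_self z)
    simpa using (List.mem_filter.1 this).2
  rw [← prod_filter u, ← prod_filter v] at hf
  rcases List.eq_nil_or_concat' (u.filter (f · ≠ 1)) with hu | ⟨p, x, hu⟩ <;>
    rcases List.eq_nil_or_concat' (v.filter (f · ≠ 1)) with hv | ⟨q, y, hv⟩ <;>
    rw [hu, hv] at hf huv'
  · exact absurd rfl hf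
  · simpa using huv'.symm.mem hg (x := y) (by simp)
  · simpa using huv'.mem hg (x := x) (by simp)
  · rw [prod_concat (ne_one hu), prod_concat (ne_one hv)] at hf
    exact ⟨p, q, x, y, ne_of_apply_ne f hf, huv'⟩

theorem IsBand.isRightAbsorbing_of_not_containsLift (hb : V.IsBand) (hg : ¬ V.IsGroupVariety)
    (hV : ¬ V.ContainsLift RightZeroMonoid) : V.IsRightAbsorbing 1 := by
  obtain ⟨p, q, x, y, hxy, huv⟩ := exists_entails_concat_of_not_containsLift hg hV
  intro M _ hM
  have law (a b : M) : b * a * b = b * a := by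
    let f (z : ℕ) : M := if z = y then b else a
    have hf (z) : f z = a ∨ f z = b := (ite_eq_or_eq (z = y) b a).symm
    have e : (p.map f).prod * a = (q.map f).prod * b := by simpa [f, hxy] using huv M hM f
    have hba : b * a = b * a * (q.map f).prod * b := by
      have := mul_prod_mul_eq_mul (hb M hM) (l := a :: p.map f) (a := a) (b := b)
        (List.forall_mem_cons.2 ⟨.inl rfl, List.forall_mem_map.2 fun z _ => hf z⟩)
      rw [List.prod_cons, ← mul_assoc, mul_assoc _ _ a, e, ← mul_assoc] at this
      exact this.symm
    rw [hba, mul_assoc _ b b, hb M hM]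
  intro f w x hx
  obtain ⟨p, q, rfl⟩ := List.append_of_mem (List.count_pos_iff.1 hx)
  simp only [List.map_append, List.map_cons, List.prod_append, List.prod_cons]
  rw [mul_assoc, law]

theorem IsChainVariety.exists_isFinitelyGenerated_of_isBand (hc : V.IsChainVariety)
    (hg : ¬ V.IsGroupVariety) (hb : V.IsBand) :
    ∃ W : Variety.{u}, W.IsFinitelyGenerated ∧ V ≤ W := by
  by_cases hV : V.ContainsLift RightZeroMonoid
  · have hVop : ¬ V.op.ContainsLift RightZeroMonoid := by
      have not_holds : ¬ Holds RightZeroMonoid [0, 1, 0] [0, 1] := fun h => by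
        cases h fun z => if z = 0 then some true else some false
      rw [op_containsLift]
      intro hop
      refine hc.not_separated hV hop (u := [0, 1, 0]) (v := [1, 0]) (u' := [0, 1, 0])
        (v' := [0, 1]) ?_ ?_ ?_ not_holds
      · exact fun f => by simpa [mul_assoc] using RightZeroMonoid.mul_mul_self (f 0) (f 1)
      · rwa [holds_mulOpposite]
      · refine holds_mulOpposite.2 fun f => ?_
        simpa [mul_assoc] using RightZeroMonoid.mul_mul_self (f 0) (f 1)
    exact exists_isFinitelyGenerated_of_op
      (hb.op.isRightAbsorbing_of_not_containsLift (mt IsGroupVariety.of_op hg)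
        hVop).exists_isFinitelyGenerated
  · exact (hb.isRightAbsorbing_of_not_containsLift hg hV).exists_isFinitelyGenerated

end Variety

end Bands

/-! ### Proper chain varieties -/

section Splitting

theorem eq_or_eq_of_perm_pair {α : Type*} {l : List α} {s t : α} (h : l.Perm [s, t]) :
    l = [s, t] ∨ l = [t, s] := by
  obtain ⟨a, b, rfl⟩ := List.length_eq_two.1 h.length_eq
  have ha : a = s ∨ a = t := by simpa using h.subset List.mem_cons_self
  rcases ha with rfl | rfl
  · exact Or.inl (by simpa using h)
  · exact Or.inr (by simpa using h.trans (.swap _ _ _))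

variable {α : Type*} [DecidableEq α] {l : List α} {s t : α}

theorem exists_split_of_count_eq_one (h : l.count t = 1) : ∃ p q, l = p ++ t :: q ∧ t ∉ p ++ q := by
  obtain ⟨p, q, rfl⟩ := List.append_of_mem (List.count_pos_iff.1 (h ▸ one_pos))
  refine ⟨p, q, rfl, List.count_eq_zero.1 ?_⟩
  simp only [List.count_append, List.count_cons_self] at h ⊢
  omega

theorem exists_split_of_filter_eq_pair (h : l.filter (fun z => z = s ∨ z = t) = [s, t]) :
    ∃ p q r, l = p ++ s :: (q ++ t :: r) ∧ s ∉ p ++ q ++ r ∧ t ∉ p ++ q ++ r := by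
  obtain ⟨p, l, rfl, hp, -, h⟩ := List.filter_eq_cons_iff.1 h
  obtain ⟨q, r, rfl, hq, -, h⟩ := List.filter_eq_cons_iff.1 h
  have hr := List.filter_eq_nil_iff.1 h
  simp only [decide_eq_true_eq, not_or] at hp hq hr
  have notMem {x : α} (hx : x = s ∨ x = t) : x ∉ p ++ q ++ r := by
    simp only [List.mem_append, not_or]
    exact ⟨⟨fun h => by simp_all, fun h => by simp_all⟩, fun h => by simp_all⟩
  exact ⟨p, q, r, rfl, notMem (.inl rfl), notMem (.inr rfl)⟩

end Splitting

namespace Variety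

variable {V : Variety.{u}} {p q p' q' u v : List ℕ} {s t x : ℕ}

theorem Entails.pow_law (h : V.Entails (p ++ t :: q) (p' ++ t :: q')) (ht : t ∉ p ++ q)
    (ht' : t ∉ p' ++ q') (hx : x ≠ t) {M : Type u} [Monoid M] (hM : V.Contains M) (a b : M) :
    a ^ p.count x * b * a ^ q.count x = a ^ p'.count x * b * a ^ q'.count x := by
  simp only [List.mem_append, not_or] at ht ht'
  simpa [Function.update_of_ne hx, map_update_of_notMem, prod_map_update_one, ht, ht',
    mul_assoc] using h M hM (Function.update (Function.update 1 x a) t b)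

/-- A chain variety that contains a monoid that is not a group, a noncommutative monoid and a monoid
that is not a band. -/
structure IsProperChain (V : Variety.{u}) : Prop where
  isChainVariety : V.IsChainVariety
  not_isGroupVariety : ¬ V.IsGroupVariety
  not_isCommutative : ¬ V.IsCommutative
  not_isBand : ¬ V.IsBand

namespace IsProperChain

theorem op (h : V.IsProperChain) : V.op.IsProperChain where
  isChainVariety := h.isChainVariety.op
  not_isGroupVariety := mt IsGroupVariety.of_op h.not_isGroupVariety
  not_isCommutative := mt IsCommutative.of_op h.not_isCommutative
  not_isBand := mt IsBand.of_op h.not_isBand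

theorem mem_iff (h : V.IsProperChain) (huv : V.Entails u v) : x ∈ u ↔ x ∈ v :=
  huv.mem_iff h.not_isGroupVariety

theorem entailsPow_succ_of_lt (h : V.IsProperChain) {i j : ℕ} (hij : i < j)
    (hV : V.EntailsPow i j) : V.EntailsPow i (i + 1) := by
  obtain ⟨n, hn⟩ := h.isChainVariety.exists_entailsPow_succ h.not_isGroupVariety
  exact hn.succ_of_lt hij hV

theorem count_eq_one (h : V.IsProperChain) (huv : V.Entails u v) (hx : u.count x = 1) :
    v.count x = 1 := by
  have hv : 0 < v.count x :=
    List.count_pos_iff.2 ((h.mem_iff huv).1 (List.count_pos_iff.1 (hx ▸ one_pos)))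
  by_contra hne
  have hpow := huv.entailsPow x
  rw [hx] at hpow
  have hsq := h.entailsPow_succ_of_lt (by omega) hpow
  exact h.not_isBand fun M _ hM m => by simpa [pow_two] using (hsq M hM m).symm

theorem isIsoterm_pair (h : V.IsProperChain) (hst : s ≠ t) : V.IsIsoterm [s, t] := by
  intro v hv
  have hperm : v.Perm [s, t] := List.perm_iff_count.2 fun z => by
    by_cases hz : z ∈ [s, t]
    · have hcount : [s, t].count z = 1 := List.count_eq_one_of_mem (by simpa using hst) hz
      rw [h.count_eq_one hv hcount, hcount]
    · rw [List.count_eq_zero.2 hz, List.count_eq_zero.2 (mt (h.mem_iff hv).2 hz)]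
  refine (eq_or_eq_of_perm_pair hperm).resolve_right ?_
  rintro rfl
  exact h.not_isCommutative fun M _ hM a b => by
    simpa [hst] using hv M hM fun z => if z = t then b else a

theorem exists_split (h : V.IsProperChain) (huv : V.Entails u v) (ht : u.count t = 1) :
    ∃ p q, v = p ++ t :: q ∧ t ∉ p ++ q :=
  exists_split_of_count_eq_one (h.count_eq_one huv ht)

theorem exists_split_pair (h : V.IsProperChain) (huv : V.Entails u v) (hst : s ≠ t)
    (hu : u.filter (fun z => z = s ∨ z = t) = [s, t]) :
    ∃ p q r, v = p ++ s :: (q ++ t :: r) ∧ s ∉ p ++ q ++ r ∧ t ∉ p ++ q ++ r := by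
  refine exists_split_of_filter_eq_pair (h.isIsoterm_pair hst _ ?_)
  simpa only [hu] using huv.filter fun z => z = s ∨ z = t

theorem entailsPow_two_three (h : V.IsProperChain) : V.EntailsPow 2 3 := by
  have not_isIsoterm_sq : ¬ V.IsIsoterm [0, 0] := by
    intro hsq
    refine h.isChainVariety.not_separated (h.isIsoterm_pair zero_ne_one).containsLift
      hsq.containsLift (u := [0, 0]) (v := [0, 0, 0]) (u' := [0, 1]) (v' := [1, 0]) ?_ ?_ ?_ ?_
    · have count_lt : ∀ c, [0, 1].count c < 2 := fun c =>
        Nat.lt_succ_of_le (List.nodup_iff_count_le_one.1 (by simp) c)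
      exact holds_factorMonoid_of_filter_eq (x := 0) count_lt (by simp) (by simp) (by simp)
    · exact not_holds_factorMonoid (by simp)
    · exact holds_factorMonoid_of_comm (k := 1) (x := 0) (y := 1) (c := 0)
        (by simp [List.count_eq_zero]) (by simp) (by simp) fun g hg => by simpa using hg
    · exact not_holds_factorMonoid (by simp)
  obtain ⟨v, hv, hne⟩ := not_isIsoterm.1 not_isIsoterm_sq
  have hv_rep : v = List.replicate v.length 0 :=
    List.eq_replicate_of_mem fun z hz => by simpa using (h.mem_iff hv).2 hz
  generalize v.length = k at hv_rep
  subst hv_rep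
  have hk₀ : k ≠ 0 := by simpa using (h.mem_iff (x := 0) hv).1 (by simp)
  have hk₁ : k ≠ 1 := fun hk => by simpa using h.count_eq_one (x := 0) hv.symm (by simp [hk])
  have hk₂ : k ≠ 2 := fun hk => hne (by simp [hk])
  exact h.entailsPow_succ_of_lt (j := k) (by omega) (by simpa using hv.entailsPow 0)

theorem pow_eq_sq (h : V.IsProperChain) {M : Type u} [Monoid M] (hM : V.Contains M) (m : M) {k : ℕ}
    (hk : 2 ≤ k) : m ^ k = m ^ 2 :=
  h.entailsPow_two_three.of_le hk le_rfl M hM m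

end IsProperChain

end Variety

/-- The monoid `{1, e, t, 0}` with `e² = e`, `te = t` and `et = t² = 0`. Squares are central in the
chain varieties that contain neither it nor its opposite. -/
inductive EMonoid : Type
  | one | e | t | zero
  deriving DecidableEq

namespace EMonoid

/-- The multiplication of `EMonoid`. -/
def mul : EMonoid → EMonoid → EMonoid
  | one, x => x
  | x, one => x
  | e, e => e
  | t, e => t
  | _, _ => zero

instance instMonoid : Monoid EMonoid where
  mul := mul
  one := one
  mul_assoc x y z := by cases x <;> cases y <;> cases z <;> rfl
  one_mul x := by cases x <;> rfl
  mul_one x := by cases x <;> rfl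

/-- The powers of `e`, which are the elements outside the ideal `{t, 0}`. -/
def IsPowerOfE (x : EMonoid) : Prop := x = 1 ∨ x = e

variable {x y : EMonoid}

theorem mul_eq_one_iff : x * y = 1 ↔ x = 1 ∧ y = 1 := by
  cases x <;> cases y <;> decide

theorem isPowerOfE_mul_iff : IsPowerOfE (x * y) ↔ IsPowerOfE x ∧ IsPowerOfE y := by
  unfold IsPowerOfE
  cases x <;> cases y <;> decide

theorem mul_eq_t_iff : x * y = t ↔ x = t ∧ IsPowerOfE y ∨ x = 1 ∧ y = t := by
  unfold IsPowerOfE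
  cases x <;> cases y <;> decide

theorem eq_of_iff (h₁ : x = 1 ↔ y = 1) (ht : x = t ↔ y = t)
    (he : IsPowerOfE x ↔ IsPowerOfE y) : x = y := by
  unfold IsPowerOfE at he
  revert h₁ ht he
  cases x <;> cases y <;> decide

variable {α : Type*} {f : α → EMonoid} {w : List α}

theorem prod_map_eq_one_iff : (w.map f).prod = 1 ↔ ∀ z ∈ w, f z = 1 := by
  induction w with
  | nil => simp
  | cons a w ih => simp [mul_eq_one_iff, ih]

theorem isPowerOfE_prod_map_iff : IsPowerOfE (w.map f).prod ↔ ∀ z ∈ w, IsPowerOfE (f z) := by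
  induction w with
  | nil => simp [IsPowerOfE]
  | cons a w ih => simp [isPowerOfE_mul_iff, ih]

theorem prod_map_eq_t_iff : (w.map f).prod = t ↔ ∃ p y q, w = p ++ y :: q ∧ f y = t ∧
    (∀ z ∈ p, f z = 1) ∧ ∀ z ∈ q, IsPowerOfE (f z) := by
  constructor
  · intro h
    induction w with
    | nil => cases h
    | cons a w ih =>
      rw [List.map_cons, List.prod_cons, mul_eq_t_iff, isPowerOfE_prod_map_iff] at h
      rcases h with ⟨ha, hw⟩ | ⟨ha, hw⟩
      · exact ⟨[], a, w, rfl, ha, by simp, hw⟩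
      · obtain ⟨p, y, q, rfl, hy, hp, hq⟩ := ih hw
        exact ⟨a :: p, y, q, rfl, hy, List.forall_mem_cons.2 ⟨ha, hp⟩, hq⟩
  · rintro ⟨p, y, q, rfl, hy, hp, hq⟩
    rw [List.map_append, List.prod_append, prod_map_eq_one_iff.2 hp, one_mul, List.map_cons,
      List.prod_cons, hy, mul_eq_t_iff, isPowerOfE_prod_map_iff]
    exact Or.inl ⟨rfl, hq⟩

theorem holds_sq_mul_mul_sq : Holds EMonoid [0, 0, 1, 0, 0] [0, 0, 1] := fun f => by
  simp only [List.map_cons, List.map_nil, List.prod_cons, List.prod_nil]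
  cases f 0 <;> cases f 1 <;> rfl

end EMonoid

namespace Variety

variable {V : Variety.{u}}

/-- The law `x²yx² ≈ yx²` holds in `V`. -/
def EntailsSqAbsorption (V : Variety.{u}) : Prop :=
  ∀ (M : Type u) [Monoid M], V.Contains M → ∀ a b : M, a ^ 2 * b * a ^ 2 = b * a ^ 2

namespace IsProperChain

theorem entailsSqAbsorption_of_notMem (h : V.IsProperChain) {p q p' q' : List ℕ} {t x : ℕ}
    (huv : V.Entails (p ++ t :: q) (p' ++ t :: q')) (ht : t ∉ p ++ q) (ht' : t ∉ p' ++ q')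
    (hp : x ∉ p) (hp' : x ∈ p') : V.EntailsSqAbsorption := by
  intro M _ hM a b
  have hx : x ≠ t := by
    rintro rfl
    exact ht' (List.mem_append_left _ hp')
  have hi : 0 < p'.count x := List.count_pos_iff.2 hp'
  have law := huv.pow_law ht ht' hx hM (a ^ 2) b
  rw [List.count_eq_zero.2 hp, pow_zero, one_mul, ← pow_mul, ← pow_mul, ← pow_mul,
    h.pow_eq_sq hM a (k := 2 * p'.count x) (by omega)] at law
  have pow_mul_sq (k : ℕ) : a ^ (2 * k) * a ^ 2 = a ^ 2 := by
    rw [← pow_add, h.pow_eq_sq hM a (by omega)]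
  calc a ^ 2 * b * a ^ 2
    _ = a ^ 2 * b * a ^ (2 * q'.count x) * a ^ 2 := by rw [mul_assoc _ (a ^ (2 * _)), pow_mul_sq]
    _ = b * a ^ (2 * q.count x) * a ^ 2 := by rw [law]
    _ = b * a ^ 2 := by rw [mul_assoc, pow_mul_sq]

theorem prod_map_eq_t (h : V.IsProperChain) (hV : ¬ V.EntailsSqAbsorption) {u v : List ℕ}
    (huv : V.Entails u v) {f : ℕ → EMonoid} (hu : (u.map f).prod = .t) : (v.map f).prod = .t := by
  obtain ⟨p, y, q, rfl, hy, hp, hq⟩ := EMonoid.prod_map_eq_t_iff.1 hu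
  have powerOfE_of_mem {z : ℕ} (hz : z ∈ p ++ q) : EMonoid.IsPowerOfE (f z) :=
    (List.mem_append.1 hz).elim (fun hz => .inl (hp z hz)) (hq z)
  have hy_notMem : y ∉ p ++ q := fun hmem => by
    rcases powerOfE_of_mem hmem with e | e <;> rw [hy] at e <;> cases e
  obtain ⟨r, s, rfl, hy'⟩ := h.exists_split huv (t := y) (by
    have := List.count_eq_zero.2 hy_notMem
    simp_all)
  have mem_of_mem {z : ℕ} (hz : z ∈ r ++ s) : z ∈ p ++ q := by
    have hzy : z ≠ y := fun e => hy' (e ▸ hz)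
    have := (h.mem_iff (x := z) huv).2 (by grind)
    grind
  refine EMonoid.prod_map_eq_t_iff.2 ⟨r, y, s, rfl, hy, fun z hz => ?_, fun z hz =>
    powerOfE_of_mem (mem_of_mem (List.mem_append_right _ hz))⟩
  by_contra hfz
  exact hV (h.entailsSqAbsorption_of_notMem huv hy_notMem hy' (fun hzp => hfz (hp z hzp)) hz)

theorem containsLift_eMonoid (h : V.IsProperChain) (hV : ¬ V.EntailsSqAbsorption) :
    V.ContainsLift EMonoid := by
  refine containsLift_iff.2 fun u v huv f => EMonoid.eq_of_iff ?_ ?_ ?_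
  · simp only [EMonoid.prod_map_eq_one_iff, h.mem_iff huv]
  · exact ⟨h.prod_map_eq_t hV huv, h.prod_map_eq_t hV huv.symm⟩
  · simp only [EMonoid.isPowerOfE_prod_map_iff, h.mem_iff huv]

end IsProperChain

end Variety

theorem mul_mul_eq_mul_mul_sq {M : Type*} [Monoid M]
    (hsq : ∀ (m : M) {k : ℕ}, 2 ≤ k → m ^ k = m ^ 2) (hdel : ∀ a b : M, a ^ 2 * b = a ^ 2 * b * a)
    {i j : ℕ} (hi : i ≠ 0) (hij : ¬ (i = 1 ∧ j = 1)) (hij' : i + j ≠ 1)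
    (hlaw : ∀ a b : M, a * b * a = a ^ i * b * a ^ j) (a b : M) : a * b * a = a * b * a ^ 2 := by
  rcases eq_or_ne i 1 with rfl | hi₁
  · rw [hlaw, hsq a (k := j) (by omega), pow_one]
  · have sq_mul_mul_pow (k : ℕ) : a ^ 2 * b * a ^ k = a ^ 2 * b := by
      induction k with
      | zero => rw [pow_zero, mul_one]
      | succ k ih => rw [pow_succ _ k, ← mul_assoc, ih, ← hdel]
    have haba : a * b * a = a ^ 2 * b := by rw [hlaw, hsq a (k := i) (by omega), sq_mul_mul_pow]
    calc a * b * a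
      _ = a ^ 2 * b * a := by rw [haba, ← hdel]
      _ = a * b * a ^ 2 := by rw [← haba, mul_assoc _ a, ← pow_two]

namespace Variety

variable {V : Variety.{u}}

theorem EntailsSqAbsorption.of_op (h : V.op.EntailsSqAbsorption) {M : Type u} [Monoid M]
    (hM : V.Contains M) (a b : M) : a ^ 2 * b * a ^ 2 = a ^ 2 * b := by
  simpa [mul_assoc] using congrArg MulOpposite.unop
    (h Mᵐᵒᵖ (op_contains_mulOpposite.2 hM) (MulOpposite.op a) (MulOpposite.op b))

namespace IsProperChain

theorem not_containsLift_op_eMonoid (h : V.IsProperChain) (hE : V.ContainsLift EMonoid) :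
    ¬ V.op.ContainsLift EMonoid := by
  rw [op_containsLift]
  intro hop
  have not_holds : ¬ Holds EMonoid [0, 0, 1, 0, 0] [1, 0, 0] := fun hc => by
    cases hc fun z => if z = 0 then .e else .t
  refine h.isChainVariety.not_separated hE hop EMonoid.holds_sq_mul_mul_sq ?_ ?_ not_holds
  · rwa [holds_mulOpposite]
  · exact holds_mulOpposite.2 EMonoid.holds_sq_mul_mul_sq

theorem not_isIsoterm_aba (h : V.IsProperChain) (hE : V.ContainsLift EMonoid) :
    ¬ V.IsIsoterm [0, 1, 0] := by
  intro hiso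
  refine h.isChainVariety.not_separated hE hiso.containsLift (u := [0, 0, 1]) (v := [0, 1, 0])
    (u' := [0, 0, 0, 1]) (v' := [1, 0, 0, 0]) ?_ ?_ ?_ ?_
  · intro f
    simp only [List.map_cons, List.map_nil, List.prod_cons, List.prod_nil]
    cases f 0 <;> cases f 1 <;> rfl
  · exact fun hc => not_holds_factorMonoid (by simp) hc.symm
  · have count_lt (c : ℕ) : [0, 1, 0].count c < 3 := by
      grind
    exact holds_factorMonoid_of_filter_eq (x := 0) count_lt (by simp) (by simp) (by simp)
  · intro hc
    cases hc fun z => if z = 0 then EMonoid.e else EMonoid.t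

theorem exists_entails_aba (h : V.IsProperChain) (hV : ¬ V.IsIsoterm [0, 1, 0]) :
    ∃ i j : ℕ, ¬ (i = 1 ∧ j = 1) ∧ i + j ≠ 1 ∧
      V.Entails [0, 1, 0] (List.replicate i 0 ++ 1 :: List.replicate j 0) := by
  obtain ⟨v, hv, hne⟩ := not_isIsoterm.1 hV
  obtain ⟨p, q, rfl, hpq⟩ := h.exists_split hv (t := 1) (by simp)
  have eq_zero {z : ℕ} (hz : z ∈ p ++ q) : z = 0 := by
    have hz₁ : z ≠ 1 := fun e => hpq (e ▸ hz)
    have := (h.mem_iff (x := z) hv).2 (by grind)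
    simpa [hz₁] using this
  obtain ⟨i, rfl⟩ : ∃ i, p = List.replicate i 0 :=
    ⟨_, List.eq_replicate_of_mem fun z hz => eq_zero (List.mem_append_left _ hz)⟩
  obtain ⟨j, rfl⟩ : ∃ j, q = List.replicate j 0 :=
    ⟨_, List.eq_replicate_of_mem fun z hz => eq_zero (List.mem_append_right _ hz)⟩
  refine ⟨i, j, ?_, fun hij => ?_, hv⟩
  · rintro ⟨rfl, rfl⟩
    exact hne rfl
  · simpa using h.count_eq_one (x := 0) hv.symm (by simpa [List.count_replicate] using hij)

theorem isRightAbsorbing_two (h : V.IsProperChain) (hE : V.ContainsLift EMonoid) :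
    V.IsRightAbsorbing 2 := by
  have hop : V.op.EntailsSqAbsorption :=
    by_contra fun hc => h.not_containsLift_op_eMonoid hE (h.op.containsLift_eMonoid hc)
  obtain ⟨i, j, hij, hij', haba⟩ := h.exists_entails_aba (h.not_isIsoterm_aba hE)
  have hi : i ≠ 0 := by
    rintro rfl
    let f (z : ℕ) : EMonoid := if z = 0 then .e else .t
    have prod_eq_t : (([] ++ 1 :: List.replicate j 0).map f).prod = .t :=
      EMonoid.prod_map_eq_t_iff.2 ⟨[], 1, _, rfl, rfl, by simp, by simp [f, EMonoid.IsPowerOfE]⟩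
    cases (containsLift_iff.1 hE _ _ haba f).trans prod_eq_t
  intro M _ hM
  have hdel (a b : M) : a ^ 2 * b = a ^ 2 * b * a := by
    rw [← hop.of_op hM, mul_assoc _ (a ^ 2) a, ← pow_succ,
      h.pow_eq_sq hM a (k := 2 + 1) (by simp)]
  exact rightAbsorbs_two (mul_mul_eq_mul_mul_sq (fun m _ => h.pow_eq_sq hM m) hdel hi hij hij'
    fun a b => by simpa [mul_assoc] using haba M hM fun z => if z = 0 then a else b) hdel

end IsProperChain

end Variety

/-! ### Central squares -/

section CentralSquares

variable {M : Type*} [Monoid M]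

theorem sq_mul_mul_pow (hsq : ∀ (m : M) {k : ℕ}, 2 ≤ k → m ^ k = m ^ 2)
    (hcen : ∀ a b : M, a ^ 2 * b = b * a ^ 2) (a b : M) (k : ℕ) :
    a ^ 2 * b * a ^ k = a ^ 2 * b := by
  rw [hcen, mul_assoc, ← pow_add, hsq a (by omega)]

theorem mul_mul_mul_mul_eq_of_two_le (hsq : ∀ (m : M) {k : ℕ}, 2 ≤ k → m ^ k = m ^ 2)
    (hcen : ∀ a b : M, a ^ 2 * b = b * a ^ 2) {i j k : ℕ} (h : 2 ≤ i ∨ 2 ≤ j ∨ 2 ≤ k) (a b c : M) :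
    a ^ i * b * a ^ j * c * a ^ k = a ^ 2 * b * c := by
  have hdel := sq_mul_mul_pow hsq hcen a
  have sq_mul_pow (k : ℕ) : a ^ 2 * a ^ k = a ^ 2 := by rw [← pow_add, hsq a (by omega)]
  rcases h with h | h | h
  · rw [hsq a h, hdel, mul_assoc (a ^ 2), hdel]
  · rw [hsq a h, ← hcen, ← mul_assoc, sq_mul_pow, mul_assoc (a ^ 2), hdel]
  · rw [hsq a h, ← hcen]
    simp only [← mul_assoc]
    rw [sq_mul_pow, hdel]

theorem mul_mul_eq_sq_mul (hsq : ∀ (m : M) {k : ℕ}, 2 ≤ k → m ^ k = m ^ 2)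
    (hcen : ∀ a b : M, a ^ 2 * b = b * a ^ 2) {i j k : ℕ} (hi : i ≤ 1) (hj : j ≤ 1) (hk : k ≤ 1)
    (hijk : i + j + k = 2)
    (hlaw : ∀ a b c : M, a * b * a * c * a = a ^ i * b * a ^ j * c * a ^ k) (a b : M) :
    a * b * a = a ^ 2 * b := by
  have hdel := sq_mul_mul_pow hsq hcen a b 1
  rcases eq_or_ne k 0 with rfl | hk₀
  · obtain ⟨rfl, rfl⟩ : i = 1 ∧ j = 1 := by omega
    have := hlaw a b 1
    simp only [pow_one, pow_zero, mul_one] at this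
    rw [← this, mul_assoc (a * b), ← pow_two, ← hcen, ← mul_assoc, ← pow_succ, hsq a (by simp)]
  · obtain rfl : k = 1 := by omega
    have := hlaw a 1 b
    rw [mul_one, mul_one, ← pow_add, show i + j = 1 by omega, pow_one, ← pow_two] at this
    rw [← this]
    simpa only [pow_one] using hdel

theorem mul_mul_mul_mul_eq_sq_mul (hsq : ∀ (m : M) {k : ℕ}, 2 ≤ k → m ^ k = m ^ 2)
    (hcen : ∀ a b : M, a ^ 2 * b = b * a ^ 2) {i j k : ℕ} (hijk : 2 ≤ i + j + k)
    (hne : ¬ (i = 1 ∧ j = 1 ∧ k = 1))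
    (hlaw : ∀ a b c : M, a * b * a * c * a = a ^ i * b * a ^ j * c * a ^ k) (a b c : M) :
    a * b * a * c * a = a ^ 2 * b * c := by
  by_cases h : 2 ≤ i ∨ 2 ≤ j ∨ 2 ≤ k
  · rw [hlaw, mul_mul_mul_mul_eq_of_two_le hsq hcen h]
  · have haba := mul_mul_eq_sq_mul hsq hcen (by omega) (by omega) (by omega) (by omega) hlaw a
    have hdel := sq_mul_mul_pow hsq hcen a (b * c) 1
    rw [haba]
    simpa only [mul_assoc, pow_one] using hdel

theorem rightAbsorbs_three (hsq : ∀ m : M, m ^ 2 = m ^ 3)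
    (hcen : ∀ a b : M, a ^ 2 * b = b * a ^ 2)
    (hlaw : ∀ a b c : M, a * b * a * c * a = a ^ 2 * b * c) : RightAbsorbs 3 M := by
  have law (a b c d : M) : a * b * a * c * a * d * a = a * b * a * c * a * d := by
    rw [hlaw, mul_assoc (a ^ 2) b c, mul_assoc (a ^ 2), hcen, mul_assoc, ← pow_succ, ← hsq]
  intro f w x hx
  obtain ⟨p, s, rfl, hp⟩ := List.eq_append_cons_of_mem
    (List.count_pos_iff.1 (show 0 < w.count x by omega))
  rw [List.count_append, List.count_cons_self, List.count_eq_zero.2 hp] at hx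
  obtain ⟨q, r, t, rfl⟩ := exists_eq_append_cons_append_cons (show 2 ≤ s.count x by omega)
  simp only [List.map_append, List.map_cons, List.prod_append, List.prod_cons]
  simpa only [mul_assoc] using congrArg ((p.map f).prod * ·)
    (law (f x) (q.map f).prod (r.map f).prod (t.map f).prod)

end CentralSquares

namespace Variety

variable {V : Variety.{u}}

/-- The law `x²y ≈ yx²` holds in `V`. -/
def HasCentralSquares (V : Variety.{u}) : Prop :=
  ∀ (M : Type u) [Monoid M], V.Contains M → ∀ a b : M, a ^ 2 * b = b * a ^ 2

namespace IsProperChain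

theorem hasCentralSquares (h : V.IsProperChain) (hE : ¬ V.ContainsLift EMonoid)
    (hE' : ¬ V.op.ContainsLift EMonoid) : V.HasCentralSquares := fun M _ hM a b => by
  have law : V.EntailsSqAbsorption := by_contra fun hV => hE (h.containsLift_eMonoid hV)
  have law_op : V.op.EntailsSqAbsorption :=
    by_contra fun hV => hE' (h.op.containsLift_eMonoid hV)
  rw [← law_op.of_op hM, law M hM]

theorem exists_entails_abaca (h : V.IsProperChain) (hV : ¬ V.IsIsoterm [0, 1, 0, 2, 0]) :
    ∃ i j k : ℕ, 2 ≤ i + j + k ∧ ¬ (i = 1 ∧ j = 1 ∧ k = 1) ∧ V.Entails [0, 1, 0, 2, 0]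
      (List.replicate i 0 ++ 1 :: (List.replicate j 0 ++ 2 :: List.replicate k 0)) := by
  obtain ⟨v, hv, hne⟩ := not_isIsoterm.1 hV
  obtain ⟨p, q, r, rfl, h₁, h₂⟩ := h.exists_split_pair hv (s := 1) (t := 2) (by simp) (by simp)
  have eq_replicate {l : List ℕ} (hl : l ⊆ p ++ q ++ r) : ∃ n, l = List.replicate n 0 := by
    refine ⟨_, List.eq_replicate_of_mem fun z hz => ?_⟩
    have hz₁ : z ≠ 1 := fun e => h₁ (e ▸ hl hz)
    have hz₂ : z ≠ 2 := fun e => h₂ (e ▸ hl hz)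
    have := (h.mem_iff (x := z) hv).2 (by grind)
    simpa [hz₁, hz₂] using this
  obtain ⟨i, rfl⟩ := eq_replicate (l := p) (by simp)
  obtain ⟨j, rfl⟩ := eq_replicate (l := q) (by simp)
  obtain ⟨k, rfl⟩ := eq_replicate (l := r) (by simp)
  refine ⟨i, j, k, ?_, ?_, hv⟩
  · have h₀ := (h.mem_iff (x := 0) hv).1 (by simp)
    have h₁ := mt (h.count_eq_one (x := 0) hv.symm) (by simp)
    rw [← List.count_pos_iff] at h₀
    simp at h₀ h₁
    omega
  · rintro ⟨rfl, rfl, rfl⟩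
    exact hne rfl

theorem isRightAbsorbing_three (h : V.IsProperChain) (hcen : V.HasCentralSquares)
    (hV : ¬ V.IsIsoterm [0, 1, 0, 2, 0]) : V.IsRightAbsorbing 3 := by
  obtain ⟨i, j, k, hijk, hne, hlaw⟩ := h.exists_entails_abaca hV
  intro M _ hM
  refine rightAbsorbs_three (h.entailsPow_two_three M hM) (hcen M hM)
    (mul_mul_mul_mul_eq_sq_mul (fun m _ => h.pow_eq_sq hM m) (hcen M hM) hijk hne fun a b c => ?_)
  simpa [mul_assoc] using hlaw M hM fun z => if z = 1 then b else if z = 2 then c else a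

end IsProperChain

end Variety

/-! ### Isoterms of the form `xyxzx` -/

namespace Variety

variable {V : Variety.{u}} {p q r p' q' r' v : List ℕ} {s t x : ℕ}

namespace IsIsoterm

theorem exponents_eq_one (h : V.IsIsoterm [0, 1, 0]) {i j : ℕ}
    (hij : ∀ (M : Type u) [Monoid M], V.Contains M → ∀ a b : M, a * b * a = a ^ i * b * a ^ j) :
    i = 1 ∧ j = 1 := by
  have key := h (List.replicate i 0 ++ 1 :: List.replicate j 0) fun M _ hM f => by
    simpa [mul_assoc] using hij M hM (f 0) (f 1)
  rcases i with _ | _ | i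
  · simp at key
  · rcases j with _ | _ | j <;> simp [List.replicate_succ] at key ⊢
  · simp [List.replicate_succ] at key

theorem of_abaca (h : V.IsIsoterm [0, 1, 0, 2, 0]) : V.IsIsoterm [0, 1, 0] :=
  of_append (p := []) (q := [2, 0]) h

theorem count_eq_one_and_iff (h : V.IsIsoterm [0, 1, 0])
    (huv : V.Entails (p ++ t :: q) (p' ++ t :: q')) (ht : t ∉ p ++ q) (ht' : t ∉ p' ++ q')
    (hx : x ≠ t) :
    p.count x = 1 ∧ q.count x = 1 ↔ p'.count x = 1 ∧ q'.count x = 1 := by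
  constructor <;> rintro ⟨hp, hq⟩ <;> refine h.exponents_eq_one fun M _ hM a b => ?_
  · simpa [hp, hq] using huv.pow_law ht ht' hx hM a b
  · simpa [hp, hq] using (huv.pow_law ht ht' hx hM a b).symm

theorem count_blocks (h : V.IsIsoterm [0, 1, 0])
    (huv : V.Entails (p ++ s :: (q ++ t :: r)) (p' ++ s :: (q' ++ t :: r')))
    (hs : s ∉ p ++ q ++ r) (ht : t ∉ p ++ q ++ r) (hs' : s ∉ p' ++ q' ++ r')
    (ht' : t ∉ p' ++ q' ++ r') (hst : s ≠ t) (hxs : x ≠ s) (hxt : x ≠ t)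
    (hx : (p ++ q ++ r).count x = 2) (hp : p.count x ≤ 1) (hq : q.count x ≤ 1)
    (hr : r.count x ≤ 1) :
    p'.count x = p.count x ∧ q'.count x = q.count x ∧ r'.count x = r.count x := by
  simp only [List.mem_append, not_or] at hs ht hs' ht'
  have left := h.count_eq_one_and_iff huv (x := x) (by simp [hs, hst]) (by simp [hs', hst]) hxs
  have right := h.count_eq_one_and_iff (p := p ++ s :: q) (p' := p' ++ s :: q') (t := t) (x := x)
    (by simpa using huv) (by simp [ht, hst.symm]) (by simp [ht', hst.symm]) hxt
  simp only [List.count_append, List.count_cons_of_ne hxs.symm,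
    List.count_cons_of_ne hxt.symm] at hx left right
  omega

end IsIsoterm

namespace IsProperChain

theorem exists_perm_blocks (h : V.IsProperChain) (hiso : V.IsIsoterm [0, 1, 0])
    (huv : V.Entails (p ++ s :: (q ++ t :: r)) v) (hst : s ≠ t) (hs : s ∉ p ++ q ++ r)
    (ht : t ∉ p ++ q ++ r) (hp : p.Nodup) (hq : q.Nodup) (hr : r.Nodup)
    (hcount : ∀ x ∈ p ++ q ++ r, (p ++ q ++ r).count x = 2) :
    ∃ p' q' r', v = p' ++ s :: (q' ++ t :: r') ∧ p'.Perm p ∧ q'.Perm q ∧ r'.Perm r := by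
  have hfilter : (p ++ s :: (q ++ t :: r)).filter (fun z => z = s ∨ z = t) = [s, t] := by
    have filter_eq_nil {l : List ℕ} (hl : l ⊆ p ++ q ++ r) :
        l.filter (fun z => z = s ∨ z = t) = [] :=
      List.filter_eq_nil_iff.2 fun z hz => by grind
    rw [List.filter_append, List.filter_cons_of_pos (by simp), List.filter_append,
      List.filter_cons_of_pos (by simp), filter_eq_nil (by simp), filter_eq_nil (by simp),
      filter_eq_nil (by simp)]
    rfl
  obtain ⟨p', q', r', rfl, hs', ht'⟩ := h.exists_split_pair huv hst hfilter
  have key (x : ℕ) :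
      p'.count x = p.count x ∧ q'.count x = q.count x ∧ r'.count x = r.count x := by
    by_cases hx : x ∈ p ++ q ++ r
    · exact hiso.count_blocks huv hs ht hs' ht' hst (fun e => hs (e ▸ hx)) (fun e => ht (e ▸ hx))
        (hcount x hx) (List.nodup_iff_count_le_one.1 hp x) (List.nodup_iff_count_le_one.1 hq x)
        (List.nodup_iff_count_le_one.1 hr x)
    · have hx' : x ∉ p' ++ q' ++ r' := by
        intro hx'
        have := (h.mem_iff huv (x := x)).2 (by grind)
        grind
      simp only [List.mem_append, not_or] at hx hx'
      simp [List.count_eq_zero.2, hx, hx']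
  exact ⟨p', q', r', rfl, List.perm_iff_count.2 fun x => (key x).1,
    List.perm_iff_count.2 fun x => (key x).2.1, List.perm_iff_count.2 fun x => (key x).2.2⟩

theorem not_isIsoterm_of_comm (h : V.IsProperChain) (hiso : V.IsIsoterm [0, 1, 0, 2, 0])
    {w w' : List ℕ} (hne : w' ≠ w) (hw : ∀ c, w.count c < 3)
    (hu : 2 ≤ w.count 0 ∧ 2 ≤ w.count 1) (hv : 2 ≤ w'.count 0 ∧ 2 ≤ w'.count 1)
    (hcomm : ∀ g : ℕ → List ℕ, g 0 ++ g 1 = g 1 ++ g 0 → w.flatMap g = w'.flatMap g) :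
    ¬ V.IsIsoterm w := by
  intro hw'
  refine h.isChainVariety.not_separated hiso.containsLift hw'.containsLift (u := w) (v := w')
    (u' := [0, 1, 0, 2, 0]) (v' := [0, 1, 0, 0, 2, 0]) ?_ ?_ ?_ ?_
  · exact holds_factorMonoid_of_comm (k := 2) (x := 0) (y := 1) (c := 0)
      (by grind) hu hv hcomm
  · exact not_holds_factorMonoid hne
  · exact holds_factorMonoid_of_filter_eq (k := 3) (x := 0) hw (by simp) (by simp) (by simp)
  · exact not_holds_factorMonoid (by simp)

variable {M : Type u} [Monoid M]

theorem sigma₁ (h : V.IsProperChain) (hiso : V.IsIsoterm [0, 1, 0, 2, 0]) (hM : V.Contains M)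
    (x y z t : M) : x * y * z * x * t * y = y * x * z * x * t * y := by
  obtain ⟨v, hv, hne⟩ := not_isIsoterm.1 <| h.not_isIsoterm_of_comm hiso
    (w := [0, 1, 2, 0, 3, 1]) (w' := [1, 0, 2, 0, 3, 1]) (by simp) (by grind) (by simp) (by simp)
    fun g hg => by simp only [List.flatMap_cons, ← List.append_assoc, hg]
  obtain ⟨p, q, r, rfl, hp, hq, hr⟩ := h.exists_perm_blocks hiso.of_abaca (s := 2) (t := 3)
    (p := [0, 1]) (q := [0]) (r := [1]) hv (by simp) (by simp) (by simp) (by simp) (by simp)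
    (by simp) (by simp)
  rw [List.perm_singleton.1 hq, List.perm_singleton.1 hr] at hv hne
  obtain rfl := (eq_or_eq_of_perm_pair hp).resolve_left (by rintro rfl; exact hne rfl)
  simpa [mul_assoc] using
    hv M hM fun i => if i = 0 then x else if i = 1 then y else if i = 2 then z else t

theorem sigma₂ (h : V.IsProperChain) (hiso : V.IsIsoterm [0, 1, 0, 2, 0]) (hM : V.Contains M)
    (x y z t : M) : x * t * y * z * x * y = x * t * y * z * y * x := by
  obtain ⟨v, hv, hne⟩ := not_isIsoterm.1 <| h.not_isIsoterm_of_comm hiso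
    (w := [0, 2, 1, 3, 0, 1]) (w' := [0, 2, 1, 3, 1, 0]) (by simp) (by grind) (by simp) (by simp)
    fun g hg => by simp only [List.flatMap_cons, List.flatMap_nil, List.append_nil, hg]
  obtain ⟨p, q, r, rfl, hp, hq, hr⟩ := h.exists_perm_blocks hiso.of_abaca (s := 2) (t := 3)
    (p := [0]) (q := [1]) (r := [0, 1]) hv (by simp) (by simp) (by simp) (by simp) (by simp)
    (by simp) (by simp)
  rw [List.perm_singleton.1 hp, List.perm_singleton.1 hq] at hv hne
  obtain rfl := (eq_or_eq_of_perm_pair hr).resolve_left (by rintro rfl; exact hne rfl)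
  simpa [mul_assoc] using
    hv M hM fun i => if i = 0 then x else if i = 1 then y else if i = 2 then t else z

theorem gamma₁ (h : V.IsProperChain) (hiso : V.IsIsoterm [0, 1, 0, 2, 0]) (hM : V.Contains M)
    (x₀ x₁ y₀ y₁ : M) : y₁ * y₀ * x₁ * y₁ * x₀ * x₁ = y₁ * y₀ * y₁ * x₁ * x₀ * x₁ := by
  obtain ⟨v, hv, hne⟩ := not_isIsoterm.1 <| h.not_isIsoterm_of_comm hiso
    (w := [1, 2, 0, 1, 3, 0]) (w' := [1, 2, 1, 0, 3, 0]) (by simp) (by grind) (by simp) (by simp)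
    fun g hg => by
      simp only [List.flatMap_cons]
      rw [← List.append_assoc (g 0), hg, List.append_assoc]
  obtain ⟨p, q, r, rfl, hp, hq, hr⟩ := h.exists_perm_blocks hiso.of_abaca (s := 2) (t := 3)
    (p := [1]) (q := [0, 1]) (r := [0]) hv (by simp) (by simp) (by simp) (by simp) (by simp)
    (by simp) (by simp)
  rw [List.perm_singleton.1 hp, List.perm_singleton.1 hr] at hv hne
  obtain rfl := (eq_or_eq_of_perm_pair hq).resolve_left (by rintro rfl; exact hne rfl)
  simpa [mul_assoc] using
    hv M hM fun i => if i = 0 then x₁ else if i = 1 then y₁ else if i = 2 then y₀ else x₀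

theorem le_varietyD (h : V.IsProperChain) (hcen : V.HasCentralSquares)
    (hiso : V.IsIsoterm [0, 1, 0, 2, 0]) : V ≤ varietyD := fun M hM =>
  varietyD_contains_iff.2
    { sq := h.entailsPow_two_three M hM
      sq_mul_comm := hcen M hM
      sigma₁ := h.sigma₁ hiso hM
      sigma₂ := h.sigma₂ hiso hM
      gamma₁ := h.gamma₁ hiso hM }

theorem exists_isFinitelyGenerated (h : V.IsProperChain) :
    ∃ W : Variety.{u}, W.IsFinitelyGenerated ∧ V ≤ W := by
  by_cases hE : V.ContainsLift EMonoid
  · exact (h.isRightAbsorbing_two hE).exists_isFinitelyGenerated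
  by_cases hE' : V.op.ContainsLift EMonoid
  · exact exists_isFinitelyGenerated_of_op
      (h.op.isRightAbsorbing_two hE').exists_isFinitelyGenerated
  have hcen := h.hasCentralSquares hE hE'
  by_cases hiso : V.IsIsoterm [0, 1, 0, 2, 0]
  · exact ⟨_, isFinitelyGenerated_generatedBy_ulift, (h.le_varietyD hcen hiso).trans varietyD_le⟩
  · exact (h.isRightAbsorbing_three hcen hiso).exists_isFinitelyGenerated

end IsProperChain

theorem IsCommutative.exists_isFinitelyGenerated (h : V.IsCommutative) {n : ℕ}
    (hn : V.EntailsPow n (n + 1)) : ∃ W : Variety.{u}, W.IsFinitelyGenerated ∧ V ≤ W :=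
  IsRightAbsorbing.exists_isFinitelyGenerated (n := n) fun M _ hM =>
    letI : CommMonoid M := { ‹Monoid M› with mul_comm := h M hM }
    rightAbsorbs_of_pow_eq (hn M hM)

theorem IsChainVariety.exists_isFinitelyGenerated (hc : V.IsChainVariety)
    (hg : ¬ V.IsGroupVariety) : ∃ W : Variety.{u}, W.IsFinitelyGenerated ∧ V ≤ W := by
  by_cases hcomm : V.IsCommutative
  · obtain ⟨n, hn⟩ := hc.exists_entailsPow_succ hg
    exact hcomm.exists_isFinitelyGenerated hn
  by_cases hband : V.IsBand
  · exact hc.exists_isFinitelyGenerated_of_isBand hg hband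
  · exact IsProperChain.exists_isFinitelyGenerated ⟨hc, hg, hcomm, hband⟩

end Variety

end MonoidVar

theorem corollary7p5 :
    (∀ V : MonoidVar.Variety.{u}, ¬ V.IsGroupVariety → V.IsChainVariety →
      (∃ W : MonoidVar.Variety.{u}, W.IsFinitelyGenerated ∧ V ≤ W) ∧ V.IsLocallyFinite) ∧
    MonoidVar.varietyD.{u} ≤
      MonoidVar.Variety.generatedBy (ULift.{u} MonoidVar.BrandtMonoid) ∧
    MonoidVar.varietyK.{u} ≤
      MonoidVar.Variety.generatedBy (ULift.{u} MonoidVar.FiveMonoid) := by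
  refine ⟨fun V hg hc => ?_, MonoidVar.varietyD_le, MonoidVar.varietyK_le⟩
  obtain ⟨W, hW, hVW⟩ := hc.exists_isFinitelyGenerated hg
  exact ⟨⟨W, hW, hVW⟩, hW.isLocallyFinite_of_le hVW⟩
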